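/- Let $m>0$ and $\omega=\sqrt{m/(m+1)}$. Let $R:\mathbb R\to\mathbb R$ be real analytic, let $W=\{(x,t): t\ge 0,\ x\ge -R(t)\}$, and let $\eta,u\in C^1(W)$ be a classical solution, up to the shoreline $x=-R(t)$, of the shallow water equations $$\eta_t+u\,(1+\eta_x)+\tfrac{m}{m+1}(x+\eta)u_x=0,\qquad u_t+uu_x+\eta_x=0,$$ with $x+\eta=0$ on the shoreline, $x+\eta>0$ off it, initial data $\eta(x,0)=\eta_0(x)$, $u(x,0)=u_0(x)$ for $x\ge -R(0)$, and $x+\eta_0(x)\to\infty$ as $x\to\infty$. Assume that the Carrier–Greenspan transformation $(x,t)\mapsto(\sigma,\tau)=(x+\eta,\,t-u)$ is invertible on $W$ (injective, with nowhere vanishing Jacobian). Let $\psi,\varphi$ be the hodograph pressure and velocity of the wave: $C^1$ functions on the half-plane $\{\sigma\ge 0\}$ with $\varphi(\sigma,\tau)=u$ and $\psi(\sigma,\tau)=\eta+u^2/2$ at the image $(\sigma,\tau)$ of each $(x,t)\in W$, continued to the rest of the half-plane (negative times) as a solution of $$\psi_\tau+\tfrac{m}{m+1}\sigma\varphi_\sigma+\varphi=0,\qquad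 \varphi_\tau+\psi_\sigma=0,\tag{H}$$ with $\tau\mapsto\psi(0,\tau)$ real analytic. Put $\psi_{\rm proj}(\sigma)=\psi(\sigma,0)$, $\varphi_{\rm proj}(\sigma)=\varphi(\sigma,0)$, $f_{\rm even}(\tau)=\frac12(f(\tau)+f(-\tau))$, $q=2\pi/\omega$, and let $\Psi(\xi)$, $\Phi(\xi)$ be the values at $\tau=q\xi$ of the even parts of $\psi(0,\cdot)$ and $\varphi(0,\cdot)$. Then: 1. $(\psi,\varphi)$ solves (H) on the whole half-plane. For all $t\in\mathbb R$, $\psi(0,t+R'(t))=R(t)+\frac12R'(t)^2$ and $\varphi(0,t+R'(t))=-R'(t)$; and $\psi(0,\cdot)$, $\varphi(0,\cdot)$ are the only real analytic functions on $\mathbb R$ that satisfy these relations for all $t\ge 0$. 2. For every $\lambda>0$ (both integrands being integrable) $$\psi_{\rm proj}(\lambda^2)=\frac{2\sqrt\pi\,\Gamma(1+\frac1m)}{\lambda\,\Gamma(\frac1m+\frac12)}\int_0^{\lambda/\pi}\Bigl(1-\bigl(\tfrac{\pi\xi}{\lambda}\bigr)^2\Bigr)^{\frac1m-\frac12}\Psi(\xi)\,d\xi,$$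 $$\varphi_{\rm proj}(\lambda^2)=\frac{2\sqrt\pi\,\Gamma(2+\frac1m)}{\lambda^{2+2/m}\,\Gamma(\frac32+\frac1m)}\int_0^{\lambda/\pi}(\lambda^2-\pi^2\xi^2)^{\frac1m+\frac12}\Phi(\xi)\,d\xi .$$ 3. $(\psi,\varphi)$ is the only $C^1$ solution of (H) on $\{\sigma\ge0\}$ whose data at $\tau=0$ are given by the right-hand sides in 2. Moreover a $C^1$ solution of (H) on $\{\sigma\ge 0\}$ has these data at $\tau=0$ if and only if its pressure on $\sigma=0$ is the observed $\psi(0,\cdot)$. 4. There is exactly one continuous $\gamma:[0,\infty)\to\mathbb R$ with $\gamma(0)=R'(0)$ and $\gamma(\sigma)=-\varphi(\sigma,\gamma(\sigma))$ for all $\sigma\ge0$. If the Jacobian of $(\sigma,\tau)\mapsto(x,t)=(\sigma-\psi+\varphi^2/2,\ \tau+\varphi)$ vanishes nowhere on $\{\sigma\ge0\}$, then $\gamma(\sigma)$ is the only root $\tau$ of $\tau=-\varphi(\sigma,\tau)$. The curve $\tau=\gamma(\sigma)$ is the image of $t=0$, that is, $\gamma(x+\eta_0(x))=-u_0(x)$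 for $x\ge -R(0)$. The map $\sigma\mapsto x=\sigma-\psi(\sigma,\gamma(\sigma))+\frac12\varphi(\sigma,\gamma(\sigma))^2$ is a bijection of $[0,\infty)$ onto $[-R(0),\infty)$, and for this $x$ $$\eta_0(x)=\psi(\sigma,\gamma(\sigma))-\tfrac12\varphi(\sigma,\gamma(\sigma))^2,\qquad u_0(x)=\varphi(\sigma,\gamma(\sigma)).$$ 5. Any two waves as above (same $m$) whose shoreline motions agree for $t\ge0$ have the same $\eta_0$ and $u_0$ on $[-R(0),\infty)$. -/

import Mathlib

noncomputable section

/-- The partial derivative of `f` in its first variable, taken within the set `S`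
(one-sided at boundary points of `S`). -/
def d1 (S : Set (ℝ × ℝ)) (f : ℝ × ℝ → ℝ) (p : ℝ × ℝ) : ℝ := fderivWithin ℝ f S p (1, 0)

/-- The partial derivative of `f` in its second variable, taken within the set `S`. -/
def d2 (S : Set (ℝ × ℝ)) (f : ℝ × ℝ → ℝ) (p : ℝ × ℝ) : ℝ := fderivWithin ℝ f S p (0, 1)

/-- The wet part of the `(x, t)` plane for `t ≥ 0`, shoreline included. If the vertical position
of the shoreline at time `t` is `R t`, its horizontal position is `-R t`, since the unperturbed
depth is `x`. -/
def wetRegion (R : ℝ → ℝ) : Set (ℝ × ℝ) := {p | 0 ≤ p.2 ∧ -R p.2 ≤ p.1}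

/-- `(η, u)` is a classical solution, up to the moving shoreline, of the shallow water equations
in a bay with parameter `m`, with initial displacement `η₀`, initial velocity `u₀`, and with
vertical shoreline motion `R`, a real analytic function. Points of the plane are `(x, t)`. -/
structure IsWave (m : ℝ) (R : ℝ → ℝ) (η u : ℝ × ℝ → ℝ) (η₀ u₀ : ℝ → ℝ) : Prop where
  analytic_R : AnalyticOnNhd ℝ R Set.univ
  smooth_η : ContDiffOn ℝ 1 η (wetRegion R)
  smooth_u : ContDiffOn ℝ 1 u (wetRegion R)
  /-- the total depth `x + η` vanishes at the shoreline -/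
  shoreline : ∀ t : ℝ, 0 ≤ t → η (-R t, t) = R t
  /-- the total depth is positive off the shoreline -/
  wet : ∀ x t : ℝ, 0 ≤ t → -R t < x → 0 < x + η (x, t)
  mass : ∀ p ∈ wetRegion R,
    d2 (wetRegion R) η p + u p * (1 + d1 (wetRegion R) η p)
      + m / (m + 1) * (p.1 + η p) * d1 (wetRegion R) u p = 0
  momentum : ∀ p ∈ wetRegion R,
    d2 (wetRegion R) u p + u p * d1 (wetRegion R) u p + d1 (wetRegion R) η p = 0
  initial_η : ∀ x : ℝ, -R 0 ≤ x → η (x, 0) = η₀ x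
  initial_u : ∀ x : ℝ, -R 0 ≤ x → u (x, 0) = u₀ x
  /-- the total depth grows without bound offshore -/
  offshore : Filter.Tendsto (fun x : ℝ => x + η₀ x) Filter.atTop Filter.atTop

/-- The Carrier–Greenspan change of independent variables `(x, t) ↦ (σ, τ)`. -/
def cgt (η u : ℝ × ℝ → ℝ) (p : ℝ × ℝ) : ℝ × ℝ := (p.1 + η p, p.2 - u p)

/-- The inverse Carrier–Greenspan change of variables `(σ, τ) ↦ (x, t)`. -/
def cgtInv (ψ φ : ℝ × ℝ → ℝ) (p : ℝ × ℝ) : ℝ × ℝ := (p.1 - ψ p + φ p ^ 2 / 2, p.2 + φ p)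

/-- The Carrier–Greenspan transformation of the wave is invertible (the wave does not break). -/
structure CGTInvertible (R : ℝ → ℝ) (η u : ℝ × ℝ → ℝ) : Prop where
  injOn : Set.InjOn (cgt η u) (wetRegion R)
  jacobian : ∀ p ∈ wetRegion R, (fderivWithin ℝ (cgt η u) (wetRegion R) p).det ≠ 0

/-- The closed hodograph half-plane; its points are `(σ, τ)`, with `σ ≥ 0`. -/
def hodographPlane : Set (ℝ × ℝ) := {p | 0 ≤ p.1}

/-- The linear hodograph system at the point `p = (σ, τ)`. -/
def HodographSystemAt (m : ℝ) (ψ φ : ℝ × ℝ → ℝ) (p : ℝ × ℝ) : Prop :=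
  d2 hodographPlane ψ p + m / (m + 1) * p.1 * d1 hodographPlane φ p + φ p = 0 ∧
    d2 hodographPlane φ p + d1 hodographPlane ψ p = 0

/-- Classical solutions of the linear hodograph system on the closed half-plane. -/
structure IsHodographSolution (m : ℝ) (ψ φ : ℝ × ℝ → ℝ) : Prop where
  smooth_ψ : ContDiffOn ℝ 1 ψ hodographPlane
  smooth_φ : ContDiffOn ℝ 1 φ hodographPlane
  system : ∀ p ∈ hodographPlane, HodographSystemAt m ψ φ p

/-- `(ψ, φ)` are the hodograph pressure and velocity of the wave `(η, u)`. On the image of the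
wet region `t ≥ 0` they are given by the Carrier–Greenspan transformation; to the rest of the
half-plane (that is, to negative times) they are continued along the linear system, with the
shoreline pressure continued analytically. That the linear system holds on the image of the wet
region is not part of the definition. -/
structure IsHodographPair (m : ℝ) (R : ℝ → ℝ) (η u ψ φ : ℝ × ℝ → ℝ) : Prop where
  smooth_ψ : ContDiffOn ℝ 1 ψ hodographPlane
  smooth_φ : ContDiffOn ℝ 1 φ hodographPlane
  velocity : ∀ p ∈ wetRegion R, φ (cgt η u p) = u p
  pressure : ∀ p ∈ wetRegion R, ψ (cgt η u p) = η p + u p ^ 2 / 2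
  continuation : ∀ p ∈ hodographPlane, p ∉ cgt η u '' wetRegion R → HodographSystemAt m ψ φ p
  analytic_shoreline : AnalyticOnNhd ℝ (fun τ : ℝ => ψ (0, τ)) Set.univ

/-- The even part of a function on the line. -/
def evenPart (g : ℝ → ℝ) (τ : ℝ) : ℝ := (g τ + g (-τ)) / 2

/-- `ω = √(m / (m + 1))`. -/
def omega (m : ℝ) : ℝ := Real.sqrt (m / (m + 1))

/-- The integrand of the transform for the pressure; `g` is the shoreline pressure. -/
def abelPsiIntegrand (m : ℝ) (g : ℝ → ℝ) (l ξ : ℝ) : ℝ :=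
  (1 - (Real.pi * ξ / l) ^ 2) ^ (1 / m - 1 / 2 : ℝ) * evenPart g (2 * Real.pi / omega m * ξ)

/-- The Abel-type transform for the pressure. -/
def abelPsi (m : ℝ) (g : ℝ → ℝ) (l : ℝ) : ℝ :=
  2 * Real.sqrt Real.pi * Real.Gamma (1 + 1 / m) / (l * Real.Gamma (1 / m + 1 / 2))
    * ∫ ξ in (0 : ℝ)..(l / Real.pi), abelPsiIntegrand m g l ξ

/-- The integrand of the transform for the velocity; `g` is the shoreline velocity. -/
def abelPhiIntegrand (m : ℝ) (g : ℝ → ℝ) (l ξ : ℝ) : ℝ :=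
  (l ^ 2 - Real.pi ^ 2 * ξ ^ 2) ^ (1 / m + 1 / 2 : ℝ) * evenPart g (2 * Real.pi / omega m * ξ)

/-- The Abel-type transform for the velocity. -/
def abelPhi (m : ℝ) (g : ℝ → ℝ) (l : ℝ) : ℝ :=
  2 * Real.sqrt Real.pi * Real.Gamma (2 + 1 / m)
      / (l ^ (2 + 2 / m : ℝ) * Real.Gamma (3 / 2 + 1 / m))
    * ∫ ξ in (0 : ℝ)..(l / Real.pi), abelPhiIntegrand m g l ξ

/-- `γ` is a continuous curve `τ = γ(σ)`, `σ ≥ 0`, that solves `γ(σ) = -φ(σ, γ(σ))` and starts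
at the shoreline point of time zero, which is `τ = R'(0)`. -/
structure IsInitialCurve (R : ℝ → ℝ) (φ : ℝ × ℝ → ℝ) (γ : ℝ → ℝ) : Prop where
  continuousOn : ContinuousOn γ (Set.Ici 0)
  start : γ 0 = deriv R 0
  equation : ∀ σ : ℝ, 0 ≤ σ → γ σ = -φ (σ, γ σ)

end

section

open Set Filter Topology MeasureTheory

/-! ### Calculus of integrals of continuous functions with a parameter -/

/-! Put `c = m / (m + 1)` and `σ = l ^ 2`. The hodograph system becomes an Euler–Poisson–Darboux
system on the whole `(l, t)` plane, `p_t + (c / 2) l q_l + q = 0` and `p_l + 2 l q_t = 0`, with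
characteristic speeds `dl/dt = ± √c / 2`. It can be evolved in either variable. In `l`, starting
from the shoreline, the energy `(p² + c l² q²) / 2` localized to a characteristic triangle does not
increase; at `l = 0` it involves `p` only, so the shoreline pressure alone determines a solution
(`IsRadialSolution.eq_zero_of_shoreline`). In `t`, the same energy weighted by a power of `l` gives
uniqueness from data at `t = 0` (`IsRadialSolution.eq_zero_of_initial`).

A solution with shoreline pressure `g` can be written down: `p` is the mean of `g` over the
characteristic interval `[t - κ l, t + κ l]` with weight `cos ^ b`, and `q` is minus the mean of
`g'` with weight `cos ^ (b + 2)`, where `b = 2 / m` and `κ = 2 / ω` (`isRadialSolution_cosMean`). By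
shoreline uniqueness every solution with smooth enough shoreline pressure has this form. At `t = 0`
the substitution `y = sin θ` turns the means into the Abel integrals, and the odd part of the data
drops out.

For the wave, the equations reduce the Jacobian of the Carrier–Greenspan map to `(1 + η_x)² - c (x +
η) u_x²`. It is a square on the shoreline and never vanishes, so it is positive everywhere; hence `1
+ η_x > 0` and the depth increases strictly offshore. The chain rule can then be inverted and yields
the linear system on the image of the wet region. Differentiating the shoreline condition gives `u =
-R'`, so the shoreline is mapped to the points `(0, t + R' t)`. These cover an interval, and
analyticity determines the shoreline pressure from `R`. Since the depth at `t = 0` runs bijectively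
over `[0, ∞)`, the image of `t = 0` is a graph `τ = γ σ`, along which the initial data are read off.
Thus `R` determines the shoreline pressure, then the hodograph pair, then `γ`, and finally the
initial data. -/

theorem hasDerivAt_intervalIntegral_of_continuous {F F' : ℝ → ℝ → ℝ}
    (hF : Continuous fun z : ℝ × ℝ => F z.1 z.2) (hF' : Continuous fun z : ℝ × ℝ => F' z.1 z.2)
    (h : ∀ x y, HasDerivAt (fun s => F s y) (F' x y) x) (a b x : ℝ) :
    HasDerivAt (fun s => ∫ y in a..b, F s y) (∫ y in a..b, F' x y) x := by
  have hK : IsCompact (Metric.closedBall x 1 ×ˢ uIcc a b) :=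
    (isCompact_closedBall x 1).prod isCompact_uIcc
  obtain ⟨C, hC⟩ := hK.exists_bound_of_continuousOn hF'.continuousOn
  have hs (s : ℝ) : Continuous (F s) := hF.comp (Continuous.prodMk_right s)
  have hs' (s : ℝ) : Continuous (F' s) := hF'.comp (Continuous.prodMk_right s)
  refine (intervalIntegral.hasDerivAt_integral_of_dominated_loc_of_deriv_le
    (bound := fun _ => C) (Metric.closedBall_mem_nhds x one_pos)
    (Eventually.of_forall fun s => (hs s).aestronglyMeasurable)
    ((hs x).intervalIntegrable a b) (hs' x).aestronglyMeasurable
    (Eventually.of_forall fun y hy s hsx => hC (s, y) ⟨hsx, uIoc_subset_uIcc hy⟩)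
    intervalIntegrable_const (Eventually.of_forall fun y _ s _ => h s y)).2

theorem continuous_intervalIntegral_of_continuous {X : Type*} [TopologicalSpace X]
    {F : X → ℝ → ℝ} (hF : Continuous fun z : X × ℝ => F z.1 z.2) (a b : ℝ) :
    Continuous fun s => ∫ y in a..b, F s y :=
  intervalIntegral.continuous_parametric_intervalIntegral_of_continuous' hF a b

theorem eq_zero_of_intervalIntegral_eq_zero {f : ℝ → ℝ} {a b x : ℝ} (hf : Continuous f)
    (h0 : ∀ y ∈ Icc a b, 0 ≤ f y) (hx : x ∈ Ioo a b) (h : ∫ y in a..b, f y = 0) : f x = 0 := by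
  by_contra hne
  have hpos : 0 < f x := lt_of_le_of_ne (h0 x (Ioo_subset_Icc_self hx)) (Ne.symm hne)
  exact (intervalIntegral.integral_pos (hx.1.trans hx.2) hf.continuousOn
    (fun y hy => h0 y (Ioc_subset_Icc_self hy)) ⟨x, Ioo_subset_Icc_self hx, hpos⟩).ne' h

/-- The squared positive part is `C¹`. Used as a cutoff, it localizes an energy to a characteristic
triangle while leaving the integration limits fixed. -/
theorem hasDerivAt_max_zero_sq (x : ℝ) :
    HasDerivAt (fun y : ℝ => max 0 y ^ 2) (2 * max 0 x) x := by
  rcases lt_trichotomy x 0 with hx | rfl | hx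
  · have : (fun y : ℝ => max 0 y ^ 2) =ᶠ[𝓝 x] fun _ => 0 := by
      filter_upwards [gt_mem_nhds hx] with y hy
      simp [max_eq_left hy.le]
    rw [max_eq_left hx.le, mul_zero]
    exact (hasDerivAt_const x (0 : ℝ)).congr_of_eventuallyEq this
  · rw [max_self, mul_zero, hasDerivAt_iff_isLittleO]
    have : (fun y : ℝ => y ^ 2) =o[𝓝 0] fun y : ℝ => y := by
      simpa using Asymptotics.isLittleO_pow_pow (𝕜 := ℝ) (m := 1) (n := 2) one_lt_two
    refine (Asymptotics.IsBigO.of_bound 1 (Eventually.of_forall fun y => ?_)).trans_isLittleO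
      (by simpa using this)
    simp only [max_self, smul_eq_mul, mul_zero, sub_zero, Real.norm_eq_abs, one_mul, ne_eq,
      OfNat.ofNat_ne_zero, not_false_eq_true, zero_pow, abs_pow, sq_abs]
    rcases le_total y 0 with hy | hy
    · rw [max_eq_left hy]; simpa using sq_nonneg y
    · rw [max_eq_right hy]
  · have : (fun y : ℝ => max 0 y ^ 2) =ᶠ[𝓝 x] fun y => y ^ 2 := by
      filter_upwards [lt_mem_nhds hx] with y hy
      simp [max_eq_right (le_of_lt hy)]
    rw [max_eq_right hx.le]
    simpa using (hasDerivAt_pow 2 x).congr_of_eventuallyEq this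

/-! ### The hodograph system in the variables `(l, t)` with `σ = l ^ 2` -/

/-- `f` is continuous with continuous partial derivatives `f₁` and `f₂`. -/
structure HasContPartials (f f₁ f₂ : ℝ → ℝ → ℝ) : Prop where
  cont : Continuous fun z : ℝ × ℝ => f z.1 z.2
  cont₁ : Continuous fun z : ℝ × ℝ => f₁ z.1 z.2
  cont₂ : Continuous fun z : ℝ × ℝ => f₂ z.1 z.2
  deriv₁ : ∀ l t, HasDerivAt (fun s => f s t) (f₁ l t) l
  deriv₂ : ∀ l t, HasDerivAt (fun s => f l s) (f₂ l t) t

/-- The hodograph system after the substitution `σ = l ^ 2`, with `c = m / (m + 1)`. -/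
structure IsRadialSolution (c : ℝ) (p p₁ p₂ q q₁ q₂ : ℝ → ℝ → ℝ) : Prop where
  partials_p : HasContPartials p p₁ p₂
  partials_q : HasContPartials q q₁ q₂
  mass : ∀ l t, p₂ l t + c / 2 * l * q₁ l t + q l t = 0
  momentum : ∀ l t, p₁ l t + 2 * l * q₂ l t = 0

theorem HasContPartials.sub {f f₁ f₂ g g₁ g₂ : ℝ → ℝ → ℝ} (hf : HasContPartials f f₁ f₂)
    (hg : HasContPartials g g₁ g₂) :
    HasContPartials (fun l t => f l t - g l t) (fun l t => f₁ l t - g₁ l t)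
      (fun l t => f₂ l t - g₂ l t) where
  cont := hf.cont.sub hg.cont
  cont₁ := hf.cont₁.sub hg.cont₁
  cont₂ := hf.cont₂.sub hg.cont₂
  deriv₁ l t := (hf.deriv₁ l t).sub (hg.deriv₁ l t)
  deriv₂ l t := (hf.deriv₂ l t).sub (hg.deriv₂ l t)

theorem IsRadialSolution.sub {c : ℝ} {p p₁ p₂ q q₁ q₂ r r₁ r₂ s s₁ s₂ : ℝ → ℝ → ℝ}
    (h : IsRadialSolution c p p₁ p₂ q q₁ q₂) (h' : IsRadialSolution c r r₁ r₂ s s₁ s₂) :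
    IsRadialSolution c (fun l t => p l t - r l t) (fun l t => p₁ l t - r₁ l t)
      (fun l t => p₂ l t - r₂ l t) (fun l t => q l t - s l t) (fun l t => q₁ l t - s₁ l t)
      (fun l t => q₂ l t - s₂ l t) where
  partials_p := h.partials_p.sub h'.partials_p
  partials_q := h.partials_q.sub h'.partials_q
  mass l t := by linear_combination h.mass l t - h'.mass l t
  momentum l t := by linear_combination h.momentum l t - h'.momentum l t

/-- Reversal of time. -/
theorem IsRadialSolution.neg_time {c : ℝ} {p p₁ p₂ q q₁ q₂ : ℝ → ℝ → ℝ}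
    (h : IsRadialSolution c p p₁ p₂ q q₁ q₂) :
    IsRadialSolution c (fun l t => p l (-t)) (fun l t => p₁ l (-t)) (fun l t => -p₂ l (-t))
      (fun l t => -q l (-t)) (fun l t => -q₁ l (-t)) (fun l t => q₂ l (-t)) where
  partials_p :=
    { cont := h.partials_p.cont.comp (continuous_fst.prodMk continuous_snd.neg)
      cont₁ := h.partials_p.cont₁.comp (continuous_fst.prodMk continuous_snd.neg)
      cont₂ := (h.partials_p.cont₂.comp (continuous_fst.prodMk continuous_snd.neg)).neg
      deriv₁ := fun l t => h.partials_p.deriv₁ l (-t)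
      deriv₂ := fun l t => by
        exact ((h.partials_p.deriv₂ l (-t)).scomp t (hasDerivAt_neg t)).congr_deriv (by simp) }
  partials_q :=
    { cont := (h.partials_q.cont.comp (continuous_fst.prodMk continuous_snd.neg)).neg
      cont₁ := (h.partials_q.cont₁.comp (continuous_fst.prodMk continuous_snd.neg)).neg
      cont₂ := h.partials_q.cont₂.comp (continuous_fst.prodMk continuous_snd.neg)
      deriv₁ := fun l t => (h.partials_q.deriv₁ l (-t)).neg
      deriv₂ := fun l t => by
        exact ((h.partials_q.deriv₂ l (-t)).scomp t (hasDerivAt_neg t)).neg.congr_deriv (by simp) }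
  mass l t := by linear_combination -h.mass l (-t)
  momentum l t := h.momentum l (-t)

/-- A solution whose pressure vanishes on the shoreline vanishes. -/
theorem IsRadialSolution.eq_zero_of_shoreline {c : ℝ} {p p₁ p₂ q q₁ q₂ : ℝ → ℝ → ℝ}
    (hc : 0 < c) (hc1 : c ≤ 2) (h : IsRadialSolution c p p₁ p₂ q q₁ q₂)
    (h0 : ∀ t, p 0 t = 0) {l₀ : ℝ} (hl₀ : 0 < l₀) (t₀ : ℝ) : p l₀ t₀ = 0 ∧ q l₀ t₀ = 0 := by
  -- `k = 2 / √c` is the slope `dt/dl` of the characteristics.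
  obtain ⟨k, hk, hck⟩ : ∃ k : ℝ, 0 < k ∧ c * k ^ 2 = 4 :=
    ⟨2 / √c, by positivity, by rw [div_pow, Real.sq_sqrt hc.le]; field_simp; norm_num⟩
  obtain ⟨L, hL⟩ : ∃ L, l₀ < L := ⟨l₀ + 1, by linarith⟩
  have hL0 : 0 < L := hl₀.trans hL
  -- For `0 ≤ l ≤ L`, the cutoff is positive exactly inside the triangle `|t - t₀| < k (L - l)` with
  -- apex `(L, t₀)`.
  set r : ℝ → ℝ → ℝ := fun l t => max 0 (k ^ 2 * (L - l) ^ 2 - (t - t₀) ^ 2) with hr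
  have hrc : Continuous fun z : ℝ × ℝ => r z.1 z.2 := by simp only [hr]; fun_prop
  have hr1 (l t : ℝ) : HasDerivAt (fun s => r s t ^ 2) (2 * r l t * (-2 * k ^ 2 * (L - l))) l := by
    have h1 : HasDerivAt (fun s => k ^ 2 * (L - s) ^ 2 - (t - t₀) ^ 2)
        (-2 * k ^ 2 * (L - l)) l :=
      (((((hasDerivAt_id l).const_sub L).pow 2).const_mul (k ^ 2)).sub_const
        ((t - t₀) ^ 2)).congr_deriv (by simp; ring)
    exact (hasDerivAt_max_zero_sq _).comp l h1
  have hr2 (l t : ℝ) : HasDerivAt (fun s => r l s ^ 2) (2 * r l t * (-2 * (t - t₀))) t := by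
    have h1 : HasDerivAt (fun s => k ^ 2 * (L - l) ^ 2 - (s - t₀) ^ 2)
        (-2 * (t - t₀)) t :=
      ((((hasDerivAt_id t).sub_const t₀).pow 2).const_sub
        (k ^ 2 * (L - l) ^ 2)).congr_deriv (by simp)
    exact (hasDerivAt_max_zero_sq _).comp t h1
  -- The factor `l ^ 2` removes `q` at `l = 0`, so no velocity data are needed on the shoreline.
  set e : ℝ → ℝ → ℝ := fun l t => (p l t ^ 2 + c * l ^ 2 * q l t ^ 2) / 2 with he
  have hpc := h.partials_p.cont
  have hp1c := h.partials_p.cont₁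
  have hp2c := h.partials_p.cont₂
  have hqc := h.partials_q.cont
  have hq1c := h.partials_q.cont₁
  have hq2c := h.partials_q.cont₂
  set E' : ℝ → ℝ → ℝ := fun l t =>
    (p l t * p₁ l t + c * l * q l t ^ 2 + c * l ^ 2 * q l t * q₁ l t) * r l t ^ 2
      + e l t * (2 * r l t * (-2 * k ^ 2 * (L - l))) with hE'
  -- `2 l p q` is the energy flux in the `t` direction. After the cutoff it vanishes at both ends of
  -- the `t` interval, so adding its `t`-derivative does not change the integral.
  set G : ℝ → ℝ → ℝ := fun l t => 2 * l * (p l t * q l t) * r l t ^ 2 with hG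
  set G' : ℝ → ℝ → ℝ := fun l t =>
    2 * l * (p₂ l t * q l t + p l t * q₂ l t) * r l t ^ 2
      + 2 * l * (p l t * q l t) * (2 * r l t * (-2 * (t - t₀))) with hG'
  have hec : Continuous fun z : ℝ × ℝ => e z.1 z.2 := by simp only [he]; fun_prop
  have hE'c : Continuous fun z : ℝ × ℝ => E' z.1 z.2 := by simp only [hE']; fun_prop
  have hG'c : Continuous fun z : ℝ × ℝ => G' z.1 z.2 := by simp only [hG']; fun_prop
  have hE (l : ℝ) : HasDerivAt (fun s => ∫ t in (t₀ - k * L)..(t₀ + k * L), e s t * r s t ^ 2)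
      (∫ t in (t₀ - k * L)..(t₀ + k * L), E' l t) l := by
    refine hasDerivAt_intervalIntegral_of_continuous (F := fun s t => e s t * r s t ^ 2)
      (hec.mul (hrc.pow 2)) hE'c (fun l t => ?_) _ _ l
    refine HasDerivAt.mul ?_ (hr1 l t)
    exact ((((h.partials_p.deriv₁ l t).pow 2).add
      (((hasDerivAt_pow 2 l).const_mul c).mul
        ((h.partials_q.deriv₁ l t).pow 2))).div_const 2).congr_deriv
      (by simp only [Pi.pow_apply]; push_cast; ring)
  have hGd (l t : ℝ) : HasDerivAt (fun s => G l s) (G' l t) t := by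
    refine HasDerivAt.mul ?_ (hr2 l t)
    exact ((h.partials_p.deriv₂ l t).mul (h.partials_q.deriv₂ l t)).const_mul (2 * l)
  have hG0 (l : ℝ) (hl : l ∈ Icc 0 L) : ∫ t in (t₀ - k * L)..(t₀ + k * L), G' l t = 0 := by
    have hr0 : ∀ t, (t - t₀) ^ 2 = (k * L) ^ 2 → r l t = 0 := fun t ht => by
      simp only [hr]
      refine max_eq_left ?_
      rw [ht, mul_pow, ← mul_sub]
      refine mul_nonpos_of_nonneg_of_nonpos (sq_nonneg k) ?_
      nlinarith [hl.1, hl.2]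
    rw [intervalIntegral.integral_eq_sub_of_hasDerivAt (fun t _ => hGd l t)
      ((hG'c.comp (Continuous.prodMk_right l)).intervalIntegrable _ _)]
    simp only [hG]
    rw [hr0 (t₀ + k * L) (by ring), hr0 (t₀ - k * L) (by ring)]
    ring
  have hle (l : ℝ) (hl : l ∈ Icc 0 L) : ∫ t in (t₀ - k * L)..(t₀ + k * L), E' l t ≤ 0 := by
    have : ∫ t in (t₀ - k * L)..(t₀ + k * L), E' l t
        = ∫ t in (t₀ - k * L)..(t₀ + k * L), (E' l t + G' l t) := by
      have i1 : Continuous fun t => E' l t := hE'c.comp (Continuous.prodMk_right l)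
      have i2 : Continuous fun t => G' l t := hG'c.comp (Continuous.prodMk_right l)
      rw [intervalIntegral.integral_add (i1.intervalIntegrable _ _) (i2.intervalIntegrable _ _),
        hG0 l hl, add_zero]
    rw [this]
    have hlim : t₀ - k * L ≤ t₀ + k * L := by nlinarith
    rw [← neg_nonneg, ← intervalIntegral.integral_neg]
    refine intervalIntegral.integral_nonneg hlim fun t _ => ?_
    rw [neg_nonneg]
    -- Energy balance: the equations give `e_l + (2 l p q)_t = -(2 - c) l q²`. What remains comes
    -- from differentiating the cutoff.
    have e1 : E' l t + G' l t = -(l * (2 - c) * (q l t * r l t) ^ 2)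
        - 4 * (r l t * (k ^ 2 * (L - l) * e l t + 2 * l * (p l t * q l t) * (t - t₀))) := by
      simp only [hE', hG']
      linear_combination p l t * r l t ^ 2 * h.momentum l t
        + 2 * l * q l t * r l t ^ 2 * h.mass l t
    have e2 : 0 ≤ l * (2 - c) * (q l t * r l t) ^ 2 :=
      mul_nonneg (mul_nonneg hl.1 (by linarith)) (sq_nonneg _)
    -- Finite propagation: completing squares gives `|2 l p q| ≤ k e`, while `|t - t₀| ≤ k (L - l)`
    -- inside the triangle.
    have e3 : 0 ≤ r l t * (k ^ 2 * (L - l) * e l t + 2 * l * (p l t * q l t) * (t - t₀)) := by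
      rcases le_or_gt (k ^ 2 * (L - l) ^ 2 - (t - t₀) ^ 2) 0 with hneg | hpos
      · simp only [hr, max_eq_left hneg, zero_mul, le_refl]
      · refine mul_nonneg (le_max_left _ _) ?_
        have a1 : |t - t₀| ≤ k * (L - l) :=
          abs_le_of_sq_le_sq (by rw [mul_pow]; linarith) (mul_nonneg hk.le (by linarith [hl.2]))
        have hce : k * e l t = k / 2 * p l t ^ 2 + 2 / k * l ^ 2 * q l t ^ 2 := by
          simp only [he]
          field_simp
          linear_combination l ^ 2 * q l t ^ 2 * hck
        have a2 : |2 * l * (p l t * q l t)| ≤ k * e l t := by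
          rw [hce, abs_le]
          have b1 : 0 ≤ k / 2 * (p l t - 2 / k * l * q l t) ^ 2 := by positivity
          have b2 : 0 ≤ k / 2 * (p l t + 2 / k * l * q l t) ^ 2 := by positivity
          have b3 : k / 2 * (p l t - 2 / k * l * q l t) ^ 2 =
            k / 2 * p l t ^ 2 + 2 / k * l ^ 2 * q l t ^ 2 - 2 * l * (p l t * q l t) := by
            field_simp; ring
          have b4 : k / 2 * (p l t + 2 / k * l * q l t) ^ 2 =
            k / 2 * p l t ^ 2 + 2 / k * l ^ 2 * q l t ^ 2 + 2 * l * (p l t * q l t) := by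
            field_simp; ring
          constructor <;> linarith
        have a3 := mul_le_mul a2 a1 (abs_nonneg _) ((abs_nonneg _).trans a2)
        rw [← abs_mul] at a3
        have a4 := neg_abs_le (2 * l * (p l t * q l t) * (t - t₀))
        nlinarith
    rw [e1]; linarith
  have hanti : AntitoneOn (fun s => ∫ t in (t₀ - k * L)..(t₀ + k * L), e s t * r s t ^ 2)
      (Icc 0 L) :=
    antitoneOn_of_hasDerivWithinAt_nonpos (convex_Icc 0 L)
      (fun l _ => (hE l).continuousAt.continuousWithinAt)
      (fun l _ => (hE l).hasDerivWithinAt) (fun l hl => hle l (interior_subset hl))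
  have henn : ∀ l t, 0 ≤ e l t * r l t ^ 2 := fun l t => by simp only [he]; positivity
  have hE0 : ∫ t in (t₀ - k * L)..(t₀ + k * L), e l₀ t * r l₀ t ^ 2 = 0 := by
    refine le_antisymm ((hanti ⟨le_rfl, hL0.le⟩ ⟨hl₀.le, hL.le⟩ hl₀.le).trans_eq ?_)
      (intervalIntegral.integral_nonneg (by nlinarith) fun t _ => henn _ _)
    simp [he, h0]
  have hz := eq_zero_of_intervalIntegral_eq_zero (x := t₀)
    ((hec.mul (hrc.pow 2)).comp (Continuous.prodMk_right l₀)) (fun t _ => henn l₀ t)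
    ⟨by nlinarith, by nlinarith⟩ hE0
  have hrpos : 0 < r l₀ t₀ := by
    simp only [hr]
    refine lt_max_of_lt_right ?_
    have : 0 < L - l₀ := by linarith
    rw [sub_self]; norm_num; positivity
  have hez : e l₀ t₀ = 0 := by
    simpa [hrpos.ne'] using hz
  simp only [he] at hez
  have hx : 0 ≤ c * l₀ ^ 2 * q l₀ t₀ ^ 2 := by positivity
  have hp0 : p l₀ t₀ ^ 2 = 0 := by nlinarith [sq_nonneg (p l₀ t₀)]
  have hq0 : c * l₀ ^ 2 * q l₀ t₀ ^ 2 = 0 := by nlinarith [sq_nonneg (p l₀ t₀)]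
  refine ⟨by simpa using hp0, ?_⟩
  simpa [hc.ne', hl₀.ne'] using hq0

/-- A solution that vanishes at time zero vanishes at later times. -/
theorem IsRadialSolution.eq_zero_of_initial_of_nonneg {c : ℝ} {p p₁ p₂ q q₁ q₂ : ℝ → ℝ → ℝ}
    (hc : 0 < c) (hc1 : c ≤ 1) (h : IsRadialSolution c p p₁ p₂ q q₁ q₂)
    (hp0 : ∀ l, 0 < l → p l 0 = 0) (hq0 : ∀ l, 0 < l → q l 0 = 0) {l₀ t₀ : ℝ} (hl₀ : 0 < l₀)
    (ht₀ : 0 ≤ t₀) : p l₀ t₀ = 0 ∧ q l₀ t₀ = 0 := by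
  -- Here `k = √c / 2` is the characteristic speed `dl/dt`.
  obtain ⟨k, hk, hck⟩ : ∃ k : ℝ, 0 < k ∧ 4 * k ^ 2 = c :=
    ⟨√c / 2, by positivity, by rw [div_pow, Real.sq_sqrt hc.le]; ring⟩
  -- The apex time `T` is late enough for the triangle `l < k (T - t)` still to contain `l₀` at time
  -- `t₀`.
  obtain ⟨T, htT, hkT⟩ : ∃ T, t₀ < T ∧ l₀ < k * (T - t₀) := by
    refine ⟨t₀ + (l₀ + 1) / k, by simp; positivity, ?_⟩
    rw [add_sub_cancel_left, mul_div_cancel₀ _ hk.ne']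
    linarith
  have hT0 : 0 < T := ht₀.trans_lt htT
  have hlM : l₀ < k * T := by nlinarith
  -- With the weight `l ^ μ`, this choice makes the flux term from differentiating `l ^ (μ + 1)`
  -- cancel the zeroth-order term `q` of the mass equation. The bound `c ≤ 1` makes `μ` nonnegative,
  -- so the weight is continuous at `0`.
  obtain ⟨μ, hμ, hcμ⟩ : ∃ μ : ℝ, 0 ≤ μ ∧ c / 2 * (μ + 1) = 1 := by
    refine ⟨2 / c - 1, ?_, by field_simp; ring⟩
    rw [sub_nonneg, le_div_iff₀ hc]; linarith
  set r : ℝ → ℝ → ℝ := fun l t => max 0 (k ^ 2 * (T - t) ^ 2 - l ^ 2) with hr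
  have hrc : Continuous fun z : ℝ × ℝ => r z.1 z.2 := by simp only [hr]; fun_prop
  have hr2 (l t : ℝ) : HasDerivAt (fun s => r l s ^ 2) (2 * r l t * (-2 * k ^ 2 * (T - t))) t := by
    have h1 : HasDerivAt (fun s => k ^ 2 * (T - s) ^ 2 - l ^ 2) (-2 * k ^ 2 * (T - t)) t :=
      (((((hasDerivAt_id t).const_sub T).pow 2).const_mul (k ^ 2)).sub_const
        (l ^ 2)).congr_deriv (by simp; ring)
    exact (hasDerivAt_max_zero_sq _).comp t h1
  have hr1 (l t : ℝ) : HasDerivAt (fun s => r s t ^ 2) (2 * r l t * (-2 * l)) l := by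
    have h1 : HasDerivAt (fun s => k ^ 2 * (T - t) ^ 2 - s ^ 2) (-2 * l) l :=
      ((hasDerivAt_pow 2 l).const_sub (k ^ 2 * (T - t) ^ 2)).congr_deriv (by simp)
    exact (hasDerivAt_max_zero_sq _).comp l h1
  set e : ℝ → ℝ → ℝ := fun l t => (p l t ^ 2 + c * l ^ 2 * q l t ^ 2) / 2 with he
  have hpc := h.partials_p.cont
  have hp1c := h.partials_p.cont₁
  have hp2c := h.partials_p.cont₂
  have hqc := h.partials_q.cont
  have hq1c := h.partials_q.cont₁
  have hq2c := h.partials_q.cont₂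
  set w : ℝ → ℝ := fun l => l ^ μ with hw
  set v : ℝ → ℝ := fun l => l ^ (μ + 1) with hv
  have hwc : Continuous w := Real.continuous_rpow_const hμ
  have hvc : Continuous v := Real.continuous_rpow_const (by linarith)
  have hvd (l : ℝ) : HasDerivAt v ((μ + 1) * w l) l := by
    simpa [hw] using Real.hasDerivAt_rpow_const (x := l) (p := μ + 1) (Or.inr (by linarith))
  have hvw (l : ℝ) (hl : 0 ≤ l) : v l = w l * l := by
    simp only [hv, hw]
    rw [Real.rpow_add_one' hl (by linarith)]
  set E' : ℝ → ℝ → ℝ := fun l t =>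
    w l * ((p l t * p₂ l t + c * l ^ 2 * q l t * q₂ l t) * r l t ^ 2
      + e l t * (2 * r l t * (-2 * k ^ 2 * (T - t)))) with hE'
  set G : ℝ → ℝ → ℝ := fun l t => c / 2 * (v l * (p l t * q l t * r l t ^ 2)) with hG
  set G' : ℝ → ℝ → ℝ := fun l t =>
    c / 2 * ((μ + 1) * w l * (p l t * q l t * r l t ^ 2)
      + v l * ((p₁ l t * q l t + p l t * q₁ l t) * r l t ^ 2
        + p l t * q l t * (2 * r l t * (-2 * l)))) with hG'
  have hec : Continuous fun z : ℝ × ℝ => e z.1 z.2 := by simp only [he]; fun_prop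
  have hE'c : Continuous fun z : ℝ × ℝ => E' z.1 z.2 := by
    simp only [hE']
    fun_prop
  have hG'c : Continuous fun z : ℝ × ℝ => G' z.1 z.2 := by
    simp only [hG']
    fun_prop
  have hE'c' (t : ℝ) : Continuous fun l => E' l t := hE'c.comp (Continuous.prodMk_left t)
  have hG'c' (t : ℝ) : Continuous fun l => G' l t := hG'c.comp (Continuous.prodMk_left t)
  have hFc : Continuous fun z : ℝ × ℝ => w z.1 * (e z.1 z.2 * r z.1 z.2 ^ 2) :=
    (hwc.comp continuous_fst).mul (hec.mul (hrc.pow 2))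
  have hE (t : ℝ) : HasDerivAt (fun s => ∫ l in (0 : ℝ)..(k * T), w l * (e l s * r l s ^ 2))
      (∫ l in (0 : ℝ)..(k * T), E' l t) t := by
    refine hasDerivAt_intervalIntegral_of_continuous
      (F := fun s l => w l * (e l s * r l s ^ 2)) (F' := fun s l => E' l s)
      (hFc.comp continuous_swap) (hE'c.comp continuous_swap) (fun t l => ?_) _ _ t
    refine HasDerivAt.const_mul (w l) (HasDerivAt.mul ?_ (hr2 l t))
    exact ((((h.partials_p.deriv₂ l t).pow 2).add
      (((h.partials_q.deriv₂ l t).pow 2).const_mul (c * l ^ 2))).div_const 2).congr_deriv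
      (by push_cast; ring)
  have hGd (l t : ℝ) : HasDerivAt (fun s => G s t) (G' l t) l :=
    ((hvd l).mul (((h.partials_p.deriv₁ l t).mul (h.partials_q.deriv₁ l t)).mul
      (hr1 l t))).const_mul (c / 2)
  have hG0 (t : ℝ) (ht : t ∈ Icc 0 T) : ∫ l in (0 : ℝ)..(k * T), G' l t = 0 := by
    have hr0 : r (k * T) t = 0 := by
      simp only [hr]
      refine max_eq_left ?_
      rw [mul_pow, ← mul_sub]
      refine mul_nonpos_of_nonneg_of_nonpos (sq_nonneg k) ?_
      nlinarith [ht.1, ht.2]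
    rw [intervalIntegral.integral_eq_sub_of_hasDerivAt (fun l _ => hGd l t)
      ((hG'c' t).intervalIntegrable _ _)]
    simp only [hG, hr0, hvw 0 le_rfl]
    ring
  have hle (t : ℝ) (ht : t ∈ Icc 0 T) : ∫ l in (0 : ℝ)..(k * T), E' l t ≤ 0 := by
    have : ∫ l in (0 : ℝ)..(k * T), E' l t = ∫ l in (0 : ℝ)..(k * T), (E' l t + G' l t) := by
      rw [intervalIntegral.integral_add ((hE'c' t).intervalIntegrable _ _)
        ((hG'c' t).intervalIntegrable _ _), hG0 t ht, add_zero]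
    rw [this, ← neg_nonneg, ← intervalIntegral.integral_neg]
    refine intervalIntegral.integral_nonneg (by positivity) fun l hl => ?_
    rw [neg_nonneg]
    -- The weighted energy satisfies an exact conservation law, so only the derivatives of the
    -- cutoff survive.
    have e1 : E' l t + G' l t = -(4 * (w l * (r l t * (k ^ 2 * (T - t) * e l t
        + l * (c / 2 * l * (p l t * q l t)))))) := by
      simp only [hE', hG', hvw l hl.1]
      linear_combination w l * p l t * r l t ^ 2 * h.mass l t
        + c / 2 * l * w l * q l t * r l t ^ 2 * h.momentum l t
        + w l * p l t * q l t * r l t ^ 2 * hcμ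
    have e3 : 0 ≤ r l t * (k ^ 2 * (T - t) * e l t + l * (c / 2 * l * (p l t * q l t))) := by
      rcases le_or_gt (k ^ 2 * (T - t) ^ 2 - l ^ 2) 0 with hneg | hpos
      · simp only [hr, max_eq_left hneg, zero_mul, le_refl]
      · refine mul_nonneg (le_max_left _ _) ?_
        have a1 : l ≤ k * (T - t) :=
          abs_le_of_sq_le_sq' (by rw [mul_pow]; linarith)
            (mul_nonneg hk.le (by linarith [ht.2])) |>.2
        have b2 : 0 ≤ k / 2 * (p l t + 2 * k * l * q l t) ^ 2 := by positivity
        have e0 : 0 ≤ e l t := by simp only [he]; positivity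
        have b4 : k / 2 * (p l t + 2 * k * l * q l t) ^ 2 =
            k * e l t + c / 2 * l * (p l t * q l t) := by
          simp only [he]
          linear_combination (k / 2 * l ^ 2 * q l t ^ 2 + l * p l t * q l t / 2) * hck
        have b5 : l * (k * e l t) ≤ k * (T - t) * (k * e l t) :=
          mul_le_mul_of_nonneg_right a1 (by positivity)
        have b6 := mul_nonneg hl.1 b2
        rw [b4] at b6
        nlinarith
    have e4 : 0 ≤ w l := Real.rpow_nonneg hl.1 μ
    rw [e1, neg_nonpos]
    positivity
  have hanti : AntitoneOn (fun s => ∫ l in (0 : ℝ)..(k * T), w l * (e l s * r l s ^ 2))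
      (Icc 0 T) :=
    antitoneOn_of_hasDerivWithinAt_nonpos (convex_Icc 0 T)
      (fun t _ => (hE t).continuousAt.continuousWithinAt)
      (fun t _ => (hE t).hasDerivWithinAt) (fun t ht => hle t (interior_subset ht))
  have henn : ∀ t, ∀ l ∈ Icc 0 (k * T), 0 ≤ w l * (e l t * r l t ^ 2) := fun t l hl => by
    have e4 : 0 ≤ w l := Real.rpow_nonneg hl.1 μ
    simp only [he]; positivity
  have hE0 : ∫ l in (0 : ℝ)..(k * T), w l * (e l t₀ * r l t₀ ^ 2) = 0 := by
    refine le_antisymm ((hanti ⟨le_rfl, hT0.le⟩ ⟨ht₀, htT.le⟩ ht₀).trans_eq ?_)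
      (intervalIntegral.integral_nonneg (by positivity) (henn t₀))
    refine intervalIntegral.integral_zero_ae (Eventually.of_forall fun l hl => ?_)
    rw [uIoc_of_le (by positivity)] at hl
    simp [he, hp0 l hl.1, hq0 l hl.1]
  have hz := eq_zero_of_intervalIntegral_eq_zero (x := l₀)
    (hFc.comp (Continuous.prodMk_left t₀)) (henn t₀) ⟨hl₀, hlM⟩ hE0
  have hrpos : 0 < r l₀ t₀ := by
    simp only [hr]
    refine lt_max_of_lt_right ?_
    nlinarith
  have hez : e l₀ t₀ = 0 := by
    have : w l₀ ≠ 0 := (Real.rpow_pos_of_pos hl₀ μ).ne'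
    simpa [hrpos.ne', this] using hz
  simp only [he] at hez
  have hx : 0 ≤ c * l₀ ^ 2 * q l₀ t₀ ^ 2 := by positivity
  have hp0 : p l₀ t₀ ^ 2 = 0 := by nlinarith [sq_nonneg (p l₀ t₀)]
  have hq0 : c * l₀ ^ 2 * q l₀ t₀ ^ 2 = 0 := by nlinarith [sq_nonneg (p l₀ t₀)]
  refine ⟨by simpa using hp0, ?_⟩
  simpa [hc.ne', hl₀.ne'] using hq0

/-- A solution that vanishes at time zero vanishes. -/
theorem IsRadialSolution.eq_zero_of_initial {c : ℝ} {p p₁ p₂ q q₁ q₂ : ℝ → ℝ → ℝ}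
    (hc : 0 < c) (hc1 : c ≤ 1) (h : IsRadialSolution c p p₁ p₂ q q₁ q₂)
    (hp0 : ∀ l, 0 < l → p l 0 = 0) (hq0 : ∀ l, 0 < l → q l 0 = 0) {l₀ : ℝ} (hl₀ : 0 < l₀)
    (t₀ : ℝ) : p l₀ t₀ = 0 ∧ q l₀ t₀ = 0 := by
  rcases le_total 0 t₀ with ht | ht
  · exact h.eq_zero_of_initial_of_nonneg hc hc1 hp0 hq0 hl₀ ht
  · simpa using h.neg_time.eq_zero_of_initial_of_nonneg hc hc1 (by simpa using hp0)
      (by simpa using hq0) hl₀ (neg_nonneg.2 ht)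

/-! ### Weighted means and Euler's beta integral -/

theorem integral_rpow_mul_one_sub_rpow {a : ℝ} (ha : -1 < a) :
    ∫ x in (0 : ℝ)..1, x ^ a * (1 - x) ^ a = Real.Gamma (a + 1) ^ 2 / Real.Gamma (2 * a + 2) := by
  have h := ProbabilityTheory.beta_eq_betaIntegralReal (a + 1) (a + 1) (by linarith) (by linarith)
  have h2 : Complex.betaIntegral ((a + 1 : ℝ) : ℂ) ((a + 1 : ℝ) : ℂ)
      = ((∫ x in (0 : ℝ)..1, x ^ a * (1 - x) ^ a : ℝ) : ℂ) := by
    rw [Complex.betaIntegral, ← intervalIntegral.integral_ofReal]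
    refine intervalIntegral.integral_congr fun x hx => ?_
    rw [uIcc_of_le zero_le_one] at hx
    have e : ((a + 1 : ℝ) : ℂ) - 1 = (a : ℂ) := by push_cast; ring
    simp only [e, Complex.ofReal_mul, Complex.ofReal_cpow hx.1,
      Complex.ofReal_cpow (sub_nonneg.2 hx.2)]
    push_cast
    rfl
  rw [h2, Complex.ofReal_re] at h
  rw [← h, ProbabilityTheory.beta, sq]
  congr 2
  ring

theorem intervalIntegrable_one_sub_sq_rpow_zero_one {a : ℝ} (ha : -1 < a) :
    IntervalIntegrable (fun y : ℝ => (1 - y ^ 2) ^ a) volume 0 1 := by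
  have h1 : IntervalIntegrable (fun y : ℝ => (1 - y) ^ a) volume 0 1 := by
    simpa using (intervalIntegral.intervalIntegrable_rpow' (a := 1) (b := 0) ha).comp_sub_left 1
  have h2 : ContinuousOn (fun y : ℝ => (1 + y) ^ a) (uIcc 0 1) := by
    refine ContinuousOn.rpow_const (by fun_prop) fun y hy => Or.inl ?_
    rw [uIcc_of_le zero_le_one] at hy
    linarith [hy.1]
  refine (h1.mul_continuousOn h2).congr fun y hy => ?_
  rw [uIoc_of_le zero_le_one] at hy
  show _ = _
  rw [← Real.mul_rpow (by linarith [hy.2]) (by linarith [hy.1])]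
  congr 1
  ring

theorem intervalIntegrable_one_sub_sq_rpow {a : ℝ} (ha : -1 < a) :
    IntervalIntegrable (fun y : ℝ => (1 - y ^ 2) ^ a) volume (-1) 1 := by
  have h := intervalIntegrable_one_sub_sq_rpow_zero_one ha
  refine IntervalIntegrable.trans (b := 0) ?_ h
  have h' := (IntervalIntegrable.iff_comp_neg).1 h
  simpa using h'.symm

/-- The substitution `y = 2 x - 1` gives the symmetric beta integral, and Legendre's duplication
formula removes `Γ(2 a + 2)`. -/
theorem integral_one_sub_sq_rpow {a : ℝ} (ha : -1 < a) :
    ∫ y in (-1 : ℝ)..1, (1 - y ^ 2) ^ a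
      = √Real.pi * Real.Gamma (a + 1) / Real.Gamma (a + 3 / 2) := by
  have h1 := intervalIntegral.integral_comp_mul_add (fun y : ℝ => (1 - y ^ 2) ^ a)
    (a := 0) (b := 1) (c := 2) two_ne_zero (-1)
  have h2 : ∫ x in (0 : ℝ)..1, (1 - (2 * x + -1) ^ 2) ^ a
      = 4 ^ a * ∫ x in (0 : ℝ)..1, x ^ a * (1 - x) ^ a := by
    rw [← intervalIntegral.integral_const_mul]
    refine intervalIntegral.integral_congr fun x hx => ?_
    rw [uIcc_of_le zero_le_one] at hx
    show _ = _
    rw [← Real.mul_rpow hx.1 (by linarith [hx.2]), ← Real.mul_rpow (by norm_num)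
      (mul_nonneg hx.1 (by linarith [hx.2]))]
    congr 1
    ring
  rw [h2, integral_rpow_mul_one_sub_rpow ha] at h1
  norm_num at h1
  have hd := Real.Gamma_mul_Gamma_add_half (a + 1)
  rw [show a + 1 + 1 / 2 = a + 3 / 2 by ring, show 2 * (a + 1) = 2 * a + 2 by ring] at hd
  have g1 : 0 < Real.Gamma (a + 3 / 2) := Real.Gamma_pos_of_pos (by linarith)
  have g2 : 0 < Real.Gamma (2 * a + 2) := Real.Gamma_pos_of_pos (by linarith)
  have e4 : (4 : ℝ) ^ a * 2 ^ (1 - (2 * a + 2)) = 1 / 2 := by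
    rw [show (4 : ℝ) = 2 ^ (2 : ℝ) by norm_num, ← Real.rpow_mul (by norm_num),
      ← Real.rpow_add (by norm_num), show 2 * a + (1 - (2 * a + 2)) = -1 by ring,
      Real.rpow_neg_one]
    norm_num
  have h3 : ∫ y in (-1 : ℝ)..1, (1 - y ^ 2) ^ a
      = 2 * (4 ^ a * (Real.Gamma (a + 1) ^ 2 / Real.Gamma (2 * a + 2))) := by
    rw [h1]; ring
  rw [h3, ← mul_div_assoc, ← mul_div_assoc, div_eq_div_iff g2.ne' g1.ne']
  linear_combination 2 * 4 ^ a * Real.Gamma (a + 1) * hd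
    + 2 * Real.Gamma (a + 1) * Real.Gamma (2 * a + 2) * √Real.pi * e4

/-- Substitute `y = sin θ`. For `b < 1` the exponent `(b - 1) / 2` is negative and the weight is
singular at `±1`, so the change of variables rests on integrability instead of continuity up to the
endpoints. -/
theorem integral_cos_rpow_mul_comp_sin {b : ℝ} (hb : 0 < b) {G : ℝ → ℝ} (hG : Continuous G) :
    ∫ θ in (-(Real.pi / 2))..(Real.pi / 2), Real.cos θ ^ b * G (Real.sin θ)
      = ∫ y in (-1 : ℝ)..1, (1 - y ^ 2) ^ ((b - 1) / 2) * G y := by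
  have hpi := Real.pi_pos
  have hle : -(Real.pi / 2) ≤ Real.pi / 2 := by linarith
  set g : ℝ → ℝ := fun y => (1 - y ^ 2) ^ ((b - 1) / 2) * G y with hg
  have key : ∀ θ ∈ Icc (-(Real.pi / 2)) (Real.pi / 2),
      Real.cos θ ^ b * G (Real.sin θ) = (g ∘ Real.sin) θ * Real.cos θ := fun θ hθ => by
    have h0 := Real.cos_nonneg_of_mem_Icc hθ
    simp only [hg, Function.comp]
    rw [← Real.cos_sq', ← Real.rpow_natCast, ← Real.rpow_mul h0,
      show ((2 : ℕ) : ℝ) * ((b - 1) / 2) = b - 1 by push_cast; ring, mul_right_comm,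
      ← Real.rpow_add_one' h0 (by linarith), sub_add_cancel]
  have hcont : Continuous fun θ => Real.cos θ ^ b * G (Real.sin θ) :=
    (Real.continuous_cos.rpow_const fun _ => Or.inr hb.le).mul (hG.comp Real.continuous_sin)
  have himg : Real.sin '' uIcc (-(Real.pi / 2)) (Real.pi / 2) ⊆ Icc (-1) 1 := by
    rintro _ ⟨θ, -, rfl⟩
    exact ⟨Real.neg_one_le_sin θ, Real.sin_le_one θ⟩
  rw [intervalIntegral.integral_congr (g := fun θ => (g ∘ Real.sin) θ * Real.cos θ)
    (fun θ hθ => key θ (by rwa [uIcc_of_le hle] at hθ))]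
  rw [intervalIntegral.integral_comp_mul_deriv''' Real.continuousOn_sin
    (fun θ _ => (Real.hasDerivAt_sin θ).hasDerivWithinAt)]
  · simp [Real.sin_neg]
  · rw [min_eq_left hle, max_eq_right hle]
    refine ContinuousOn.mul (ContinuousOn.rpow_const (by fun_prop) ?_) hG.continuousOn
    rintro _ ⟨θ, hθ, rfl⟩
    left
    rw [← Real.cos_sq']
    exact (pow_pos (Real.cos_pos_of_mem_Ioo hθ) 2).ne'
  · refine IntegrableOn.mono_set ?_ himg
    rw [integrableOn_Icc_iff_integrableOn_Ioc, ← intervalIntegrable_iff_integrableOn_Ioc_of_le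
      (by norm_num)]
    exact (intervalIntegrable_one_sub_sq_rpow (by linarith)).mul_continuousOn hG.continuousOn
  · rw [uIcc_of_le hle]
    exact (hcont.integrableOn_Icc).congr_fun key measurableSet_Icc

/-- The constant that normalizes the weight `cos ^ b` on `[-π / 2, π / 2]`. -/
noncomputable def cosWeightConst (b : ℝ) : ℝ :=
  Real.Gamma (b / 2 + 1) / (√Real.pi * Real.Gamma (b / 2 + 1 / 2))

/-- The recursion `Γ(x + 1) = x Γ(x)` relates the normalizations of the pressure and velocity means.
-/
theorem cosWeightConst_add_two {b : ℝ} (hb : 0 < b) :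
    cosWeightConst (b + 2) * (b + 1) = cosWeightConst b * (b + 2) := by
  have e1 : Real.Gamma ((b + 2) / 2 + 1) = (b / 2 + 1) * Real.Gamma (b / 2 + 1) := by
    rw [← Real.Gamma_add_one (by linarith)]; congr 1; ring
  have e2 : Real.Gamma ((b + 2) / 2 + 1 / 2) = (b / 2 + 1 / 2) * Real.Gamma (b / 2 + 1 / 2) := by
    rw [← Real.Gamma_add_one (by linarith)]; congr 1; ring
  have g2 : 0 < Real.Gamma (b / 2 + 1 / 2) := Real.Gamma_pos_of_pos (by linarith)
  have hs : 0 < √Real.pi := Real.sqrt_pos.2 Real.pi_pos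
  have hb1 : b / 2 + 1 / 2 ≠ 0 := by linarith
  rw [cosWeightConst, cosWeightConst, e1, e2]
  field_simp

theorem cosWeightConst_mul_integral {b : ℝ} (hb : 0 < b) :
    cosWeightConst b * ∫ θ in (-(Real.pi / 2))..(Real.pi / 2), Real.cos θ ^ b = 1 := by
  have h := integral_cos_rpow_mul_comp_sin hb (continuous_const (y := (1 : ℝ)))
  simp only [mul_one] at h
  rw [h, integral_one_sub_sq_rpow (by linarith), cosWeightConst,
    show (b - 1) / 2 + 1 = b / 2 + 1 / 2 by ring, show (b - 1) / 2 + 3 / 2 = b / 2 + 1 by ring]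
  have g1 : 0 < Real.Gamma (b / 2 + 1) := Real.Gamma_pos_of_pos (by linarith)
  have g2 : 0 < Real.Gamma (b / 2 + 1 / 2) := Real.Gamma_pos_of_pos (by linarith)
  have hs : 0 < √Real.pi := Real.sqrt_pos.2 Real.pi_pos
  field_simp

/-- The mean of `g` over `[t - κ * l, t + κ * l]` with respect to the weight `cos ^ b`. -/
noncomputable def cosMean (b κ : ℝ) (g : ℝ → ℝ) (l t : ℝ) : ℝ :=
  cosWeightConst b * ∫ θ in (-(Real.pi / 2))..(Real.pi / 2),
    Real.cos θ ^ b * g (t + κ * l * Real.sin θ)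

theorem cosMean_zero {b : ℝ} (hb : 0 < b) (κ : ℝ) (g : ℝ → ℝ) (t : ℝ) :
    cosMean b κ g 0 t = g t := by
  simp only [cosMean, mul_zero, zero_mul, add_zero, intervalIntegral.integral_mul_const]
  rw [← mul_assoc, cosWeightConst_mul_integral hb, one_mul]

theorem hasContPartials_cosMean {b : ℝ} (hb : 0 < b) (κ : ℝ) {g g' : ℝ → ℝ}
    (hg : ∀ t, HasDerivAt g (g' t) t) (hg' : Continuous g') :
    HasContPartials (cosMean b κ g)
      (fun l t => cosWeightConst b * ∫ θ in (-(Real.pi / 2))..(Real.pi / 2),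
        Real.cos θ ^ b * (κ * Real.sin θ * g' (t + κ * l * Real.sin θ)))
      (cosMean b κ g') := by
  have hgc : Continuous g := continuous_iff_continuousAt.2 fun t => (hg t).continuousAt
  have hw : Continuous fun θ => Real.cos θ ^ b :=
    Real.continuous_cos.rpow_const fun _ => Or.inr hb.le
  have c0 : Continuous fun z : (ℝ × ℝ) × ℝ =>
      Real.cos z.2 ^ b * g (z.1.2 + κ * z.1.1 * Real.sin z.2) :=
    (hw.comp continuous_snd).mul (by fun_prop)
  have c1 : Continuous fun z : (ℝ × ℝ) × ℝ =>
      Real.cos z.2 ^ b * g' (z.1.2 + κ * z.1.1 * Real.sin z.2) :=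
    (hw.comp continuous_snd).mul (by fun_prop)
  have c2 : Continuous fun z : (ℝ × ℝ) × ℝ => Real.cos z.2 ^ b *
      (κ * Real.sin z.2 * g' (z.1.2 + κ * z.1.1 * Real.sin z.2)) :=
    (hw.comp continuous_snd).mul (by fun_prop)
  refine ⟨(continuous_intervalIntegral_of_continuous (F := fun (z : ℝ × ℝ) θ => Real.cos θ ^ b *
      g (z.2 + κ * z.1 * Real.sin θ)) c0 _ _).const_mul _,
    (continuous_intervalIntegral_of_continuous (F := fun (z : ℝ × ℝ) θ => Real.cos θ ^ b *
      (κ * Real.sin θ * g' (z.2 + κ * z.1 * Real.sin θ))) c2 _ _).const_mul _,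
    (continuous_intervalIntegral_of_continuous (F := fun (z : ℝ × ℝ) θ => Real.cos θ ^ b *
      g' (z.2 + κ * z.1 * Real.sin θ)) c1 _ _).const_mul _, fun l t => ?_, fun l t => ?_⟩
  · refine (hasDerivAt_intervalIntegral_of_continuous
      (F := fun l θ => Real.cos θ ^ b * g (t + κ * l * Real.sin θ))
      (F' := fun l θ => Real.cos θ ^ b * (κ * Real.sin θ * g' (t + κ * l * Real.sin θ)))
      ((hw.comp continuous_snd).mul (by fun_prop))
      ((hw.comp continuous_snd).mul (by fun_prop)) (fun l θ => HasDerivAt.const_mul _ ?_) _ _ l).const_mul _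
    have h1 : HasDerivAt (fun l => t + κ * l * Real.sin θ) (κ * Real.sin θ) l :=
      ((((hasDerivAt_id l).const_mul κ).mul_const (Real.sin θ)).const_add t).congr_deriv
        (by simp)
    exact ((hg _).comp l h1).congr_deriv (mul_comm _ _)
  · refine (hasDerivAt_intervalIntegral_of_continuous
      (F := fun t θ => Real.cos θ ^ b * g (t + κ * l * Real.sin θ))
      (F' := fun t θ => Real.cos θ ^ b * g' (t + κ * l * Real.sin θ))
      ((hw.comp continuous_snd).mul (by fun_prop))
      ((hw.comp continuous_snd).mul (by fun_prop)) (fun t θ => HasDerivAt.const_mul _ ?_) _ _ t).const_mul _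
    exact ((hg _).comp t ((hasDerivAt_id t).add_const _)).congr_deriv (by simp)

theorem hasDerivAt_cos_rpow_add_one {b : ℝ} (hb : 0 < b) (θ : ℝ) :
    HasDerivAt (fun θ => Real.cos θ ^ (b + 1)) (-((b + 1) * Real.cos θ ^ b * Real.sin θ)) θ := by
  have h := (Real.hasDerivAt_cos θ).rpow_const (p := b + 1) (Or.inr (by linarith))
  refine h.congr_deriv ?_
  rw [add_sub_cancel_right]
  ring

/-- Integrate the `θ`-derivative of `κ cos ^ (b + 1) θ * h`; the cosine removes the endpoint terms.
With `h = g'` this becomes the momentum equation for the means. -/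
theorem integral_cos_rpow_mul_sin {b : ℝ} (hb : 0 < b) (κ l t : ℝ) {h h' : ℝ → ℝ}
    (hh : ∀ t, HasDerivAt h (h' t) t) (hh' : Continuous h') :
    (b + 1) * ∫ θ in (-(Real.pi / 2))..(Real.pi / 2),
        Real.cos θ ^ b * (κ * Real.sin θ * h (t + κ * l * Real.sin θ))
      = κ ^ 2 * l * ∫ θ in (-(Real.pi / 2))..(Real.pi / 2),
        Real.cos θ ^ (b + 2) * h' (t + κ * l * Real.sin θ) := by
  have hpi := Real.pi_pos
  have hle : -(Real.pi / 2) ≤ Real.pi / 2 := by linarith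
  have hhc : Continuous h := continuous_iff_continuousAt.2 fun t => (hh t).continuousAt
  have w0 : Continuous fun θ => Real.cos θ ^ b :=
    Real.continuous_cos.rpow_const fun _ => Or.inr hb.le
  have w2 : Continuous fun θ => Real.cos θ ^ (b + 2) :=
    Real.continuous_cos.rpow_const fun _ => Or.inr (by linarith)
  have i1 : Continuous fun θ => Real.cos θ ^ b * (κ * Real.sin θ * h (t + κ * l * Real.sin θ)) := by
    fun_prop
  have i2 : Continuous fun θ => Real.cos θ ^ (b + 2) * h' (t + κ * l * Real.sin θ) := by
    fun_prop
  have hd : ∀ θ ∈ uIcc (-(Real.pi / 2)) (Real.pi / 2), HasDerivAt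
      (fun θ => κ * (Real.cos θ ^ (b + 1) * h (t + κ * l * Real.sin θ)))
      (κ ^ 2 * l * (Real.cos θ ^ (b + 2) * h' (t + κ * l * Real.sin θ))
        - (b + 1) * (Real.cos θ ^ b * (κ * Real.sin θ * h (t + κ * l * Real.sin θ)))) θ := by
    intro θ hθ
    rw [uIcc_of_le hle] at hθ
    have h0 := Real.cos_nonneg_of_mem_Icc hθ
    have h1 : HasDerivAt (fun θ => t + κ * l * Real.sin θ) (κ * l * Real.cos θ) θ :=
      ((Real.hasDerivAt_sin θ).const_mul (κ * l)).const_add t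
    refine (((hasDerivAt_cos_rpow_add_one hb θ).mul ((hh _).comp θ h1)).const_mul
      κ).congr_deriv ?_
    have r1 : Real.cos θ ^ (b + 2) = Real.cos θ ^ (b + 1) * Real.cos θ := by
      rw [← Real.rpow_add_one' h0 (by linarith)]; congr 1; ring
    rw [r1]
    simp only [Function.comp]
    ring
  have hI := intervalIntegral.integral_eq_sub_of_hasDerivAt hd
    (((i2.const_mul _).sub (i1.const_mul _)).intervalIntegrable _ _)
  rw [intervalIntegral.integral_sub ((i2.const_mul _).intervalIntegrable _ _)
    ((i1.const_mul _).intervalIntegrable _ _), intervalIntegral.integral_const_mul,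
    intervalIntegral.integral_const_mul] at hI
  rw [Real.cos_neg, Real.cos_pi_div_two, Real.zero_rpow (by linarith)] at hI
  linarith

/-- Integrate the `θ`-derivative of `cos ^ (b + 1) θ * sin θ * h` and replace `sin²` by `1 - cos²`.
With `h = g'` this becomes the mass equation for the means. -/
theorem integral_cos_rpow_mul_sin_sq {b : ℝ} (hb : 0 < b) (κ l t : ℝ) {h h' : ℝ → ℝ}
    (hh : ∀ t, HasDerivAt h (h' t) t) (hh' : Continuous h') :
    l * ∫ θ in (-(Real.pi / 2))..(Real.pi / 2),
        Real.cos θ ^ (b + 2) * (κ * Real.sin θ * h' (t + κ * l * Real.sin θ))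
      = (b + 1) * (∫ θ in (-(Real.pi / 2))..(Real.pi / 2),
          Real.cos θ ^ b * h (t + κ * l * Real.sin θ))
        - (b + 2) * ∫ θ in (-(Real.pi / 2))..(Real.pi / 2),
          Real.cos θ ^ (b + 2) * h (t + κ * l * Real.sin θ) := by
  have hpi := Real.pi_pos
  have hle : -(Real.pi / 2) ≤ Real.pi / 2 := by linarith
  have hhc : Continuous h := continuous_iff_continuousAt.2 fun t => (hh t).continuousAt
  have w0 : Continuous fun θ => Real.cos θ ^ b :=
    Real.continuous_cos.rpow_const fun _ => Or.inr hb.le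
  have w2 : Continuous fun θ => Real.cos θ ^ (b + 2) :=
    Real.continuous_cos.rpow_const fun _ => Or.inr (by linarith)
  have i1 : Continuous fun θ => Real.cos θ ^ b * h (t + κ * l * Real.sin θ) := by
    fun_prop
  have i2 : Continuous fun θ => Real.cos θ ^ (b + 2) * h (t + κ * l * Real.sin θ) := by
    fun_prop
  have i3 : Continuous fun θ =>
      Real.cos θ ^ (b + 2) * (κ * Real.sin θ * h' (t + κ * l * Real.sin θ)) := by
    fun_prop
  have hd : ∀ θ ∈ uIcc (-(Real.pi / 2)) (Real.pi / 2), HasDerivAt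
      (fun θ => Real.cos θ ^ (b + 1) * Real.sin θ * h (t + κ * l * Real.sin θ))
      (l * (Real.cos θ ^ (b + 2) * (κ * Real.sin θ * h' (t + κ * l * Real.sin θ)))
        - ((b + 1) * (Real.cos θ ^ b * h (t + κ * l * Real.sin θ))
        - (b + 2) * (Real.cos θ ^ (b + 2) * h (t + κ * l * Real.sin θ)))) θ := by
    intro θ hθ
    rw [uIcc_of_le hle] at hθ
    have h0 := Real.cos_nonneg_of_mem_Icc hθ
    have h1 : HasDerivAt (fun θ => t + κ * l * Real.sin θ) (κ * l * Real.cos θ) θ :=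
      ((Real.hasDerivAt_sin θ).const_mul (κ * l)).const_add t
    refine (((hasDerivAt_cos_rpow_add_one hb θ).mul (Real.hasDerivAt_sin θ)).mul
      ((hh _).comp θ h1)).congr_deriv ?_
    have r1 : Real.cos θ ^ (b + 2) = Real.cos θ ^ (b + 1) * Real.cos θ := by
      rw [← Real.rpow_add_one' h0 (by linarith)]; congr 1; ring
    simp only [Function.comp, Pi.mul_apply]
    rw [r1, Real.rpow_add_one' h0 (by linarith : b + 1 ≠ 0)]
    linear_combination -(b + 1) * Real.cos θ ^ b * h (t + κ * l * Real.sin θ) *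
      Real.sin_sq_add_cos_sq θ
  have c23 : Continuous fun θ => (b + 1) * (Real.cos θ ^ b * h (t + κ * l * Real.sin θ))
      - (b + 2) * (Real.cos θ ^ (b + 2) * h (t + κ * l * Real.sin θ)) :=
    (i1.const_mul (b + 1)).sub (i2.const_mul (b + 2))
  have hI := intervalIntegral.integral_eq_sub_of_hasDerivAt hd
    (((i3.const_mul _).sub c23).intervalIntegrable _ _)
  rw [intervalIntegral.integral_sub ((i3.const_mul _).intervalIntegrable _ _)
    (c23.intervalIntegrable _ _),
    intervalIntegral.integral_sub ((i1.const_mul _).intervalIntegrable _ _)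
    ((i2.const_mul _).intervalIntegrable _ _), intervalIntegral.integral_const_mul,
    intervalIntegral.integral_const_mul, intervalIntegral.integral_const_mul] at hI
  rw [Real.cos_neg, Real.cos_pi_div_two, Real.zero_rpow (by linarith)] at hI
  linarith

/-- The solution with prescribed shoreline pressure `g`. -/
theorem isRadialSolution_cosMean {b c κ : ℝ} (hb : 0 < b) (hc : c * (b + 2) = 2)
    (hκ : κ ^ 2 = 2 * (b + 2)) {g g' g'' : ℝ → ℝ} (hg : ∀ t, HasDerivAt g (g' t) t)
    (hg' : ∀ t, HasDerivAt g' (g'' t) t) (hg'' : Continuous g'') :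
    ∃ p₁ p₂ q₁ q₂, IsRadialSolution c (cosMean b κ g) p₁ p₂
      (fun l t => -cosMean (b + 2) κ g' l t) q₁ q₂ := by
  have hg'c : Continuous g' := continuous_iff_continuousAt.2 fun t => (hg' t).continuousAt
  have hP := hasContPartials_cosMean hb κ hg hg'c
  have hQ := hasContPartials_cosMean (b := b + 2) (by linarith) κ hg' hg''
  have hC := cosWeightConst_add_two hb
  have hb1 : b + 1 ≠ 0 := by linarith
  refine ⟨_, _, _, _, hP, ⟨hQ.cont.neg, hQ.cont₁.neg, hQ.cont₂.neg,
    fun l t => (hQ.deriv₁ l t).neg, fun l t => (hQ.deriv₂ l t).neg⟩, fun l t => ?_, fun l t => ?_⟩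
  · have h := integral_cos_rpow_mul_sin_sq hb κ l t hg' hg''
    simp only [cosMean]
    generalize (∫ θ in (-(Real.pi / 2))..(Real.pi / 2), Real.cos θ ^ (b + 2) *
      (κ * Real.sin θ * g'' (t + κ * l * Real.sin θ))) = I at *
    generalize (∫ θ in (-(Real.pi / 2))..(Real.pi / 2), Real.cos θ ^ (b + 2) *
      g' (t + κ * l * Real.sin θ)) = J at *
    generalize (∫ θ in (-(Real.pi / 2))..(Real.pi / 2), Real.cos θ ^ b *
      g' (t + κ * l * Real.sin θ)) = K at *
    linear_combination (-(c / 2) * cosWeightConst (b + 2)) * h - c / 2 * K * hC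
      + (cosWeightConst (b + 2) * J - cosWeightConst b * K) / 2 * hc
  · have h := integral_cos_rpow_mul_sin hb κ l t hg' hg''
    simp only [cosMean]
    generalize (∫ θ in (-(Real.pi / 2))..(Real.pi / 2), Real.cos θ ^ b *
      (κ * Real.sin θ * g' (t + κ * l * Real.sin θ))) = I at *
    generalize (∫ θ in (-(Real.pi / 2))..(Real.pi / 2), Real.cos θ ^ (b + 2) *
      g'' (t + κ * l * Real.sin θ)) = J at *
    refine mul_left_cancel₀ hb1 ?_
    linear_combination cosWeightConst b * h + cosWeightConst b * l * J * hκ - 2 * l * J * hC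

/-- Solutions with twice differentiable shoreline pressure are weighted means of it. -/
theorem IsRadialSolution.eq_cosMean {b c κ : ℝ} {p p₁ p₂ q q₁ q₂ : ℝ → ℝ → ℝ} (hb : 0 < b)
    (hc : c * (b + 2) = 2) (hκ : κ ^ 2 = 2 * (b + 2)) (h : IsRadialSolution c p p₁ p₂ q q₁ q₂)
    {g'' : ℝ → ℝ} (hg' : ∀ t, HasDerivAt (p₂ 0) (g'' t) t) (hg'' : Continuous g'')
    {l : ℝ} (hl : 0 < l) (t : ℝ) :
    p l t = cosMean b κ (p 0) l t ∧ q l t = cosMean (b + 2) κ (q 0) l t := by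
  obtain ⟨r₁, r₂, s₁, s₂, hr⟩ :=
    isRadialSolution_cosMean hb hc hκ (fun t => h.partials_p.deriv₂ 0 t) hg' hg''
  have hc0 : 0 < c := by
    by_contra hcon
    nlinarith
  have := (h.sub hr).eq_zero_of_shoreline hc0 (by nlinarith)
    (fun t => by rw [cosMean_zero hb, sub_self]) hl t
  refine ⟨sub_eq_zero.1 this.1, (sub_eq_zero.1 this.2).trans ?_⟩
  -- The mass equation degenerates at `l = 0` and ties the shoreline velocity to the shoreline
  -- pressure.
  have hq0 : q 0 = fun t => -p₂ 0 t := by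
    funext t
    linear_combination h.mass 0 t
  simp [cosMean, hq0]

/-! ### The Abel transforms as weighted means -/

theorem integral_mul_evenPart {w G : ℝ → ℝ} (hw : ∀ y, w (-y) = w y)
    (hi : IntervalIntegrable (fun y => w y * G y) volume (-1) 1) :
    IntervalIntegrable (fun y => w y * evenPart G y) volume 0 1 ∧
      2 * ∫ y in (0 : ℝ)..1, w y * evenPart G y = ∫ y in (-1 : ℝ)..1, w y * G y := by
  have i1 : IntervalIntegrable (fun y => w y * G y) volume 0 1 :=
    hi.mono_set (by
      rw [uIcc_of_le zero_le_one, uIcc_of_le (by norm_num)]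
      exact Icc_subset_Icc (by norm_num) le_rfl)
  have i2 : IntervalIntegrable (fun y => w y * G y) volume (-1) 0 :=
    hi.mono_set (by
      rw [uIcc_of_le (by norm_num), uIcc_of_le (by norm_num)]
      exact Icc_subset_Icc le_rfl (by norm_num))
  have i3 : IntervalIntegrable (fun y => w y * G (-y)) volume 0 1 := by
    have h := (IntervalIntegrable.iff_comp_neg).1 i2
    simpa [hw] using h.symm
  have e : ∀ y, w y * evenPart G y = (w y * G y + w y * G (-y)) / 2 := fun y => by
    simp only [evenPart]; ring
  simp only [e]
  refine ⟨(i1.add i3).div_const 2, ?_⟩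
  rw [intervalIntegral.integral_div, intervalIntegral.integral_add i1 i3]
  have h4 : ∫ y in (0 : ℝ)..1, w y * G (-y) = ∫ y in (-1 : ℝ)..0, w y * G y := by
    have h := intervalIntegral.integral_comp_neg (fun y => w y * G y) (a := 0) (b := 1)
    simpa [hw] using h
  rw [h4, ← intervalIntegral.integral_add_adjacent_intervals i2 i1]
  ring

/-- At `t = 0` the interval of the mean is symmetric and the weight is even, so only the even part
of `g` contributes. -/
theorem cosMean_eq_integral_evenPart {b : ℝ} (hb : 0 < b) (κ l : ℝ) {g : ℝ → ℝ}
    (hg : Continuous g) :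
    IntervalIntegrable (fun y => (1 - y ^ 2) ^ ((b - 1) / 2) * evenPart g (κ * l * y)) volume 0 1 ∧
      cosMean b κ g l 0 = cosWeightConst b *
        (2 * ∫ y in (0 : ℝ)..1, (1 - y ^ 2) ^ ((b - 1) / 2) * evenPart g (κ * l * y)) := by
  have hG : Continuous fun y => g (κ * l * y) := by fun_prop
  have h := integral_mul_evenPart (w := fun y => (1 - y ^ 2) ^ ((b - 1) / 2)) (by simp)
    ((intervalIntegrable_one_sub_sq_rpow (a := (b - 1) / 2)
      (by linarith)).mul_continuousOn hG.continuousOn)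
  have e : ∀ y, evenPart (fun y => g (κ * l * y)) y = evenPart g (κ * l * y) := fun y => by
    simp [evenPart]
  simp only [e] at h
  refine ⟨h.1, ?_⟩
  rw [h.2, cosMean, ← integral_cos_rpow_mul_comp_sin hb hG]
  simp

theorem intervalIntegral_comp_pi_div_mul {l : ℝ} (hl : 0 < l) {V : ℝ → ℝ}
    (hV : IntervalIntegrable V volume 0 1) :
    IntervalIntegrable (fun ξ => V (Real.pi / l * ξ)) volume 0 (l / Real.pi) ∧
      ∫ ξ in (0 : ℝ)..(l / Real.pi), V (Real.pi / l * ξ)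
        = l / Real.pi * ∫ y in (0 : ℝ)..1, V y := by
  have hpi := Real.pi_pos
  have hne : Real.pi / l ≠ 0 := by positivity
  constructor
  · have h := hV.comp_mul_left (c := Real.pi / l)
    simpa using h
  · rw [intervalIntegral.integral_comp_mul_left V hne, mul_zero,
      div_mul_div_cancel₀ hl.ne', div_self hpi.ne', inv_div, smul_eq_mul]

/-- Rescale by `y = π ξ / l`; the rest is bookkeeping of constants with `b = 2 / m` and `κ = 2 / ω`.
-/
theorem abelPsi_eq_cosMean {m l : ℝ} (hm : 0 < m) (hl : 0 < l) {g : ℝ → ℝ} (hg : Continuous g) :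
    IntervalIntegrable (abelPsiIntegrand m g l) volume 0 (l / Real.pi) ∧
      abelPsi m g l = cosMean (2 / m) (2 / omega m) g l 0 := by
  have hb : 0 < 2 / m := by positivity
  obtain ⟨hi, hM⟩ := cosMean_eq_integral_evenPart hb (2 / omega m) l hg
  obtain ⟨hi', hM'⟩ := intervalIntegral_comp_pi_div_mul hl hi
  have e : abelPsiIntegrand m g l = fun ξ => (1 - (Real.pi / l * ξ) ^ 2) ^ ((2 / m - 1) / 2)
      * evenPart g (2 / omega m * l * (Real.pi / l * ξ)) := by
    funext ξ
    rw [abelPsiIntegrand]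
    congr 2
    · ring
    · ring
    · field_simp
  have hs : 0 < √Real.pi := Real.sqrt_pos.2 Real.pi_pos
  have hsq : √Real.pi ^ 2 = Real.pi := Real.sq_sqrt Real.pi_pos.le
  have g2 : 0 < Real.Gamma (1 / m + 1 / 2) := Real.Gamma_pos_of_pos (by positivity)
  refine ⟨e ▸ hi', ?_⟩
  rw [abelPsi, e, hM', hM, cosWeightConst, show 2 / m / 2 = 1 / m by ring, add_comm 1 (1 / m)]
  generalize (∫ y in (0 : ℝ)..1, (1 - y ^ 2) ^ ((2 / m - 1) / 2) *
    evenPart g (2 / omega m * l * y)) = I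
  generalize Real.Gamma (1 / m + 1 / 2) = A at *
  generalize Real.Gamma (1 / m + 1) = B
  field_simp
  rw [hsq]
  ring

theorem abelPhi_eq_cosMean {m l : ℝ} (hm : 0 < m) (hl : 0 < l) {g : ℝ → ℝ} (hg : Continuous g) :
    IntervalIntegrable (abelPhiIntegrand m g l) volume 0 (l / Real.pi) ∧
      abelPhi m g l = cosMean (2 / m + 2) (2 / omega m) g l 0 := by
  have hpi := Real.pi_pos
  have hb : 0 < 2 / m + 2 := by positivity
  obtain ⟨hi, hM⟩ := cosMean_eq_integral_evenPart hb (2 / omega m) l hg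
  obtain ⟨hi', hM'⟩ := intervalIntegral_comp_pi_div_mul hl hi
  have hle : 0 ≤ l / Real.pi := by positivity
  -- The factor `l ^ (2 / m + 1)` comes from extracting `l ^ 2` from the base of the power. The
  -- split needs a nonnegative base, hence the restriction to the interval of integration.
  have e : ∀ ξ ∈ Icc 0 (l / Real.pi), l ^ (2 / m + 1) *
      ((1 - (Real.pi / l * ξ) ^ 2) ^ ((2 / m + 2 - 1) / 2)
        * evenPart g (2 / omega m * l * (Real.pi / l * ξ))) = abelPhiIntegrand m g l ξ := by
    intro ξ hξ
    have h1 : 0 ≤ 1 - (Real.pi / l * ξ) ^ 2 := by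
      have : Real.pi / l * ξ ≤ 1 := by
        have h2 := mul_le_mul_of_nonneg_left hξ.2 (by positivity : 0 ≤ Real.pi / l)
        rwa [div_mul_div_cancel₀ hl.ne', div_self hpi.ne'] at h2
      have h3 : 0 ≤ Real.pi / l * ξ := mul_nonneg (by positivity) hξ.1
      nlinarith
    have h2 : l ^ 2 - Real.pi ^ 2 * ξ ^ 2 = l ^ 2 * (1 - (Real.pi / l * ξ) ^ 2) := by
      field_simp
    rw [abelPhiIntegrand, h2, Real.mul_rpow (sq_nonneg l) h1, ← Real.rpow_natCast l 2,
      ← Real.rpow_mul hl.le, show ((2 : ℕ) : ℝ) * (1 / m + 1 / 2) = 2 / m + 1 by push_cast; ring,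
      show (2 / m + 2 - 1) / 2 = 1 / m + 1 / 2 by ring,
      show 2 / omega m * l * (Real.pi / l * ξ) = 2 * Real.pi / omega m * ξ by field_simp]
    ring
  have hs : 0 < √Real.pi := Real.sqrt_pos.2 Real.pi_pos
  have hsq : √Real.pi ^ 2 = Real.pi := Real.sq_sqrt Real.pi_pos.le
  have g2 : 0 < Real.Gamma (1 / m + 3 / 2) := Real.Gamma_pos_of_pos (by positivity)
  refine ⟨(hi'.const_mul (l ^ (2 / m + 1))).congr fun ξ hξ => e ξ ?_, ?_⟩
  · rw [uIoc_of_le hle] at hξ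
    exact Ioc_subset_Icc_self hξ
  have hint : ∫ ξ in (0 : ℝ)..(l / Real.pi), abelPhiIntegrand m g l ξ
      = l ^ (2 / m + 1) * (l / Real.pi * ∫ y in (0 : ℝ)..1,
        (1 - y ^ 2) ^ ((2 / m + 2 - 1) / 2) * evenPart g (2 / omega m * l * y)) := by
    rw [← hM', ← intervalIntegral.integral_const_mul]
    refine intervalIntegral.integral_congr fun ξ hξ => ?_
    rw [uIcc_of_le hle] at hξ
    exact (e ξ hξ).symm
  rw [abelPhi, hint, hM, cosWeightConst, show (2 / m + 2) / 2 + 1 = 2 + 1 / m by ring,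
    show (2 / m + 2) / 2 + 1 / 2 = 1 / m + 3 / 2 by ring, add_comm (3 / 2) (1 / m),
    show 2 + 2 / m = 2 / m + 1 + 1 by ring, Real.rpow_add_one hl.ne' (2 / m + 1)]
  have hlp : 0 < l ^ (2 / m + 1) := Real.rpow_pos_of_pos hl _
  generalize (∫ y in (0 : ℝ)..1, (1 - y ^ 2) ^ ((2 / m + 2 - 1) / 2) *
    evenPart g (2 / omega m * l * y)) = I
  generalize l ^ (2 / m + 1) = X at *
  generalize Real.Gamma (1 / m + 3 / 2) = A at *
  generalize Real.Gamma (2 + 1 / m) = B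
  field_simp
  rw [hsq]
  ring

/-! ### Partial derivatives within a set -/

theorem fderivWithin_apply_eq (S : Set (ℝ × ℝ)) (f : ℝ × ℝ → ℝ) (p : ℝ × ℝ) (a b : ℝ) :
    fderivWithin ℝ f S p (a, b) = a * d1 S f p + b * d2 S f p := by
  have : ((a, b) : ℝ × ℝ) = a • ((1 : ℝ), (0 : ℝ)) + b • ((0 : ℝ), (1 : ℝ)) := by simp
  rw [this, map_add, map_smul, map_smul, d1, d2, smul_eq_mul, smul_eq_mul]

theorem ContDiffOn.continuousOn_d1 {S : Set (ℝ × ℝ)} {f : ℝ × ℝ → ℝ} (hf : ContDiffOn ℝ 1 f S)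
    (hS : UniqueDiffOn ℝ S) : ContinuousOn (d1 S f) S :=
  (hf.continuousOn_fderivWithin hS le_rfl).clm_apply continuousOn_const

theorem ContDiffOn.continuousOn_d2 {S : Set (ℝ × ℝ)} {f : ℝ × ℝ → ℝ} (hf : ContDiffOn ℝ 1 f S)
    (hS : UniqueDiffOn ℝ S) : ContinuousOn (d2 S f) S :=
  (hf.continuousOn_fderivWithin hS le_rfl).clm_apply continuousOn_const

theorem ContDiffOn.hasFDerivWithinAt_of_mem {S : Set (ℝ × ℝ)} {f : ℝ × ℝ → ℝ}
    (hf : ContDiffOn ℝ 1 f S) {p : ℝ × ℝ} (hp : p ∈ S) :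
    HasFDerivWithinAt f (fderivWithin ℝ f S p) S p :=
  ((hf.differentiableOn one_ne_zero) p hp).hasFDerivWithinAt

/-- The derivative of a function along a curve. -/
theorem ContDiffOn.hasDerivWithinAt_comp_curve {S : Set (ℝ × ℝ)} {f : ℝ × ℝ → ℝ}
    (hf : ContDiffOn ℝ 1 f S) {I : Set ℝ} {x y : ℝ → ℝ} {x' y' s : ℝ}
    (hx : HasDerivWithinAt x x' I s) (hy : HasDerivWithinAt y y' I s)
    (hS : ∀ r ∈ I, (x r, y r) ∈ S) (hs : s ∈ I) :
    HasDerivWithinAt (fun r => f (x r, y r))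
      (x' * d1 S f (x s, y s) + y' * d2 S f (x s, y s)) I s := by
  rw [← fderivWithin_apply_eq]
  exact (hf.hasFDerivWithinAt_of_mem (hS s hs)).comp_hasDerivWithinAt s (hx.prodMk hy) hS

theorem ContinuousLinearMap.det_prod_real (A : ℝ × ℝ →L[ℝ] ℝ × ℝ) :
    A.det = (A (1, 0)).1 * (A (0, 1)).2 - (A (0, 1)).1 * (A (1, 0)).2 := by
  rw [ContinuousLinearMap.det, ← LinearMap.det_toMatrix (Module.Basis.finTwoProd ℝ),
    Matrix.det_fin_two]
  simp [LinearMap.toMatrix_apply]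

theorem pos_of_isPreconnected {X : Type*} [TopologicalSpace X] {S : Set X} (hS : IsPreconnected S)
    {f : X → ℝ} (hf : ContinuousOn f S) (h0 : ∀ x ∈ S, f x ≠ 0) {a x : X} (ha : a ∈ S)
    (hfa : 0 < f a) (hx : x ∈ S) : 0 < f x := by
  by_contra hcon
  obtain ⟨y, hy, hfy⟩ := hS.intermediate_value hx ha hf ⟨not_lt.1 hcon, hfa.le⟩
  exact h0 y hy hfy

/-! ### Solutions of the hodograph system -/

theorem hodographPlane_eq : hodographPlane = Ici (0 : ℝ) ×ˢ (univ : Set ℝ) := by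
  ext p; simp [hodographPlane]

theorem uniqueDiffOn_hodographPlane : UniqueDiffOn ℝ hodographPlane := by
  rw [hodographPlane_eq]
  exact (uniqueDiffOn_Ici 0).prod uniqueDiffOn_univ

theorem isPreconnected_hodographPlane : IsPreconnected hodographPlane := by
  rw [hodographPlane_eq]
  exact isPreconnected_Ici.prod isPreconnected_univ

theorem hodographPlane_subset_closure : hodographPlane ⊆ closure {p : ℝ × ℝ | 0 < p.1} := by
  have : {p : ℝ × ℝ | 0 < p.1} = Ioi (0 : ℝ) ×ˢ (univ : Set ℝ) := by ext p; simp
  rw [this, closure_prod_eq, closure_Ioi, closure_univ, hodographPlane_eq]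

theorem ContDiffOn.hasDerivAt_snd_of_hodographPlane {f : ℝ × ℝ → ℝ}
    (hf : ContDiffOn ℝ 1 f hodographPlane) {σ : ℝ} (hσ : 0 ≤ σ) (τ : ℝ) :
    HasDerivAt (fun s => f (σ, s)) (d2 hodographPlane f (σ, τ)) τ := by
  have h := hf.hasDerivWithinAt_comp_curve (I := univ) (x := fun _ => σ) (y := fun s => s) (s := τ)
    (hasDerivWithinAt_const τ univ σ) (hasDerivWithinAt_id τ univ) (fun _ _ => hσ) (mem_univ τ)
  simpa using h

/-- The map `l ↦ l ^ 2` folds the line onto `[0, ∞)`, so the boundary `σ = 0` becomes interior and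
one-sided derivatives become two-sided ones. -/
theorem ContDiffOn.hasContPartials_sq {f : ℝ × ℝ → ℝ} (hf : ContDiffOn ℝ 1 f hodographPlane) :
    HasContPartials (fun l t => f (l ^ 2, t)) (fun l t => 2 * l * d1 hodographPlane f (l ^ 2, t))
      (fun l t => d2 hodographPlane f (l ^ 2, t)) := by
  have hmap : ∀ z : ℝ × ℝ, ((z.1 ^ 2, z.2) : ℝ × ℝ) ∈ hodographPlane := fun z => sq_nonneg z.1
  have hc : Continuous fun z : ℝ × ℝ => ((z.1 ^ 2, z.2) : ℝ × ℝ) := by fun_prop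
  refine ⟨hf.continuousOn.comp_continuous hc hmap,
    (by fun_prop : Continuous fun z : ℝ × ℝ => 2 * z.1).mul
      ((hf.continuousOn_d1 uniqueDiffOn_hodographPlane).comp_continuous hc hmap),
    (hf.continuousOn_d2 uniqueDiffOn_hodographPlane).comp_continuous hc hmap,
    fun l t => ?_, fun l t => hf.hasDerivAt_snd_of_hodographPlane (sq_nonneg l) t⟩
  have h := hf.hasDerivWithinAt_comp_curve (I := univ) (x := fun s => s ^ 2) (y := fun _ => t)
    (s := l) (hasDerivAt_pow 2 l).hasDerivWithinAt (hasDerivWithinAt_const l univ t)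
    (fun s _ => hmap (s, t)) (mem_univ l)
  simpa using h

theorem IsHodographSolution.isRadialSolution {m : ℝ} {ψ φ : ℝ × ℝ → ℝ}
    (h : IsHodographSolution m ψ φ) :
    IsRadialSolution (m / (m + 1)) (fun l t => ψ (l ^ 2, t))
      (fun l t => 2 * l * d1 hodographPlane ψ (l ^ 2, t))
      (fun l t => d2 hodographPlane ψ (l ^ 2, t)) (fun l t => φ (l ^ 2, t))
      (fun l t => 2 * l * d1 hodographPlane φ (l ^ 2, t))
      (fun l t => d2 hodographPlane φ (l ^ 2, t)) where
  partials_p := h.smooth_ψ.hasContPartials_sq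
  partials_q := h.smooth_φ.hasContPartials_sq
  mass l t := by
    have := (h.system (l ^ 2, t) (sq_nonneg l)).1
    simp only at this
    linear_combination this
  momentum l t := by
    have := (h.system (l ^ 2, t) (sq_nonneg l)).2
    linear_combination 2 * l * this

theorem eqOn_hodographPlane_of_forall_pos {f g : ℝ × ℝ → ℝ}
    (hf : ContDiffOn ℝ 1 f hodographPlane) (hg : ContDiffOn ℝ 1 g hodographPlane)
    (h : ∀ l : ℝ, 0 < l → ∀ t, f (l ^ 2, t) = g (l ^ 2, t)) : EqOn f g hodographPlane := by
  refine EqOn.of_subset_closure (s := {p : ℝ × ℝ | 0 < p.1}) ?_ hf.continuousOn hg.continuousOn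
    (fun p (hp : 0 < p.1) => show 0 ≤ p.1 from hp.le) hodographPlane_subset_closure
  rintro ⟨σ, τ⟩ hσ
  have := h (√σ) (Real.sqrt_pos.2 hσ) τ
  rwa [Real.sq_sqrt (le_of_lt hσ)] at this

theorem IsHodographSolution.eqOn_of_shoreline {m : ℝ} (hm : 0 < m) {ψ φ ψ' φ' : ℝ × ℝ → ℝ}
    (h : IsHodographSolution m ψ φ) (h' : IsHodographSolution m ψ' φ')
    (h0 : ∀ τ, ψ' (0, τ) = ψ (0, τ)) :
    EqOn ψ' ψ hodographPlane ∧ EqOn φ' φ hodographPlane := by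
  have hc : 0 < m / (m + 1) := by positivity
  have hc1 : m / (m + 1) ≤ 2 := by rw [div_le_iff₀ (by linarith)]; linarith
  have key := fun l hl t => (h'.isRadialSolution.sub h.isRadialSolution).eq_zero_of_shoreline hc hc1
    (fun t => by simp [h0]) (l₀ := l) hl t
  exact ⟨eqOn_hodographPlane_of_forall_pos h'.smooth_ψ h.smooth_ψ
      fun l hl t => sub_eq_zero.1 (key l hl t).1,
    eqOn_hodographPlane_of_forall_pos h'.smooth_φ h.smooth_φ
      fun l hl t => sub_eq_zero.1 (key l hl t).2⟩

theorem IsHodographSolution.eqOn_of_initial {m : ℝ} (hm : 0 < m) {ψ φ ψ' φ' : ℝ × ℝ → ℝ}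
    (h : IsHodographSolution m ψ φ) (h' : IsHodographSolution m ψ' φ')
    (h0 : ∀ l : ℝ, 0 < l → ψ' (l ^ 2, 0) = ψ (l ^ 2, 0) ∧ φ' (l ^ 2, 0) = φ (l ^ 2, 0)) :
    EqOn ψ' ψ hodographPlane ∧ EqOn φ' φ hodographPlane := by
  have hc : 0 < m / (m + 1) := by positivity
  have hc1 : m / (m + 1) ≤ 1 := by rw [div_le_iff₀ (by linarith)]; linarith
  have key := fun l hl t => (h'.isRadialSolution.sub h.isRadialSolution).eq_zero_of_initial hc hc1
    (fun l hl => sub_eq_zero.2 (h0 l hl).1) (fun l hl => sub_eq_zero.2 (h0 l hl).2) (l₀ := l) hl t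
  exact ⟨eqOn_hodographPlane_of_forall_pos h'.smooth_ψ h.smooth_ψ
      fun l hl t => sub_eq_zero.1 (key l hl t).1,
    eqOn_hodographPlane_of_forall_pos h'.smooth_φ h.smooth_φ
      fun l hl t => sub_eq_zero.1 (key l hl t).2⟩

theorem IsHodographSolution.shoreline_velocity {m : ℝ} {ψ φ : ℝ × ℝ → ℝ}
    (h : IsHodographSolution m ψ φ) (τ : ℝ) :
    φ (0, τ) = -deriv (fun τ => ψ (0, τ)) τ := by
  rw [(h.smooth_ψ.hasDerivAt_snd_of_hodographPlane le_rfl τ).deriv]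
  have := (h.system (0, τ) (le_refl (0 : ℝ))).1
  simp only [mul_zero, zero_mul, add_zero] at this
  linarith

/-- Analyticity supplies the two continuous derivatives of the shoreline pressure that the
representation by means requires. -/
theorem IsHodographSolution.inversion {m : ℝ} (hm : 0 < m) {ψ φ : ℝ × ℝ → ℝ}
    (h : IsHodographSolution m ψ φ) (ha : AnalyticOnNhd ℝ (fun τ => ψ (0, τ)) univ) {l : ℝ}
    (hl : 0 < l) :
    (IntervalIntegrable (abelPsiIntegrand m (fun τ => ψ (0, τ)) l) volume 0 (l / Real.pi) ∧
      ψ (l ^ 2, 0) = abelPsi m (fun τ => ψ (0, τ)) l) ∧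
    (IntervalIntegrable (abelPhiIntegrand m (fun τ => φ (0, τ)) l) volume 0 (l / Real.pi) ∧
      φ (l ^ 2, 0) = abelPhi m (fun τ => φ (0, τ)) l) := by
  have hb : 0 < 2 / m := by positivity
  have hψ : Continuous fun τ => ψ (0, τ) := continuousOn_univ.1 ha.continuousOn
  have hφ : Continuous fun τ => φ (0, τ) := by
    simp only [h.shoreline_velocity]
    exact (continuousOn_univ.1 ha.deriv.continuousOn).neg
  have hc : m / (m + 1) * (2 / m + 2) = 2 := by field_simp; ring
  have hκ : (2 / omega m) ^ 2 = 2 * (2 / m + 2) := by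
    rw [div_pow, omega, Real.sq_sqrt (by positivity)]
    field_simp
    ring
  have hd : (fun t => d2 hodographPlane ψ ((0 : ℝ) ^ 2, t)) = deriv fun τ => ψ (0, τ) := by
    funext t
    rw [zero_pow two_ne_zero]
    exact (h.smooth_ψ.hasDerivAt_snd_of_hodographPlane le_rfl t).deriv.symm
  have key := h.isRadialSolution.eq_cosMean hb hc hκ (g'' := deriv (deriv fun τ => ψ (0, τ)))
    (fun t => by
      rw [hd]
      exact (ha.deriv t (mem_univ t)).differentiableAt.hasDerivAt)
    (continuousOn_univ.1 ha.deriv.deriv.continuousOn) hl 0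
  simp only [zero_pow two_ne_zero] at key
  have h1 := abelPsi_eq_cosMean hm hl hψ
  have h2 := abelPhi_eq_cosMean hm hl hφ
  exact ⟨⟨h1.1, key.1.trans h1.2.symm⟩, ⟨h2.1, key.2.trans h2.2.symm⟩⟩

/-! ### The wet region -/

/-- Shearing by `R` straightens the shoreline, so unique differentiability and connectedness can be
transferred from the quadrant. -/
theorem wetRegion_eq_image (R : ℝ → ℝ) :
    wetRegion R = (fun p : ℝ × ℝ => (p.1 - R p.2, p.2)) '' (Ici (0 : ℝ) ×ˢ Ici (0 : ℝ)) := by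
  ext ⟨x, t⟩
  constructor
  · rintro ⟨ht, hx⟩
    simp only at ht hx
    exact ⟨(x + R t, t), ⟨by simp; linarith, ht⟩, by simp⟩
  · rintro ⟨⟨y, s⟩, ⟨hy, hs⟩, h⟩
    simp only [Prod.mk.injEq, mem_Ici] at h hy hs
    obtain ⟨rfl, rfl⟩ := h
    exact ⟨hs, by simp; linarith⟩

theorem uniqueDiffOn_wetRegion {R : ℝ → ℝ} (hR : Differentiable ℝ R) :
    UniqueDiffOn ℝ (wetRegion R) := by
  rw [wetRegion_eq_image]
  refine ((uniqueDiffOn_Ici 0).prod (uniqueDiffOn_Ici 0)).image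
    (f' := fun p => (ContinuousLinearMap.fst ℝ ℝ ℝ
      - (ContinuousLinearMap.toSpanSingleton ℝ (deriv R p.2)).comp
        (ContinuousLinearMap.snd ℝ ℝ ℝ)).prod (ContinuousLinearMap.snd ℝ ℝ ℝ))
    (fun p _ => HasFDerivAt.hasFDerivWithinAt ?_) fun p _ => Function.Surjective.denseRange ?_
  · exact (hasFDerivAt_fst.sub ((hR p.2).hasDerivAt.hasFDerivAt.comp p hasFDerivAt_snd)).prodMk
      hasFDerivAt_snd
  · rintro ⟨x, t⟩
    exact ⟨(x + t * deriv R p.2, t), by simp⟩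

theorem isPreconnected_wetRegion {R : ℝ → ℝ} (hR : Continuous R) :
    IsPreconnected (wetRegion R) := by
  rw [wetRegion_eq_image]
  exact (isPreconnected_Ici.prod isPreconnected_Ici).image _ (by fun_prop)

theorem shoreline_mem_wetRegion (R : ℝ → ℝ) {t : ℝ} (ht : 0 ≤ t) : (-R t, t) ∈ wetRegion R :=
  ⟨ht, le_rfl⟩

/-! ### The wave before transformation: Jacobian, depth and shoreline velocity -/

namespace IsWave

variable {m : ℝ} {R : ℝ → ℝ} {η u : ℝ × ℝ → ℝ} {η₀ u₀ : ℝ → ℝ}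

theorem differentiable_R (hw : IsWave m R η u η₀ u₀) : Differentiable ℝ R :=
  fun t => (hw.analytic_R t (mem_univ t)).differentiableAt

theorem uniqueDiffOn (hw : IsWave m R η u η₀ u₀) : UniqueDiffOn ℝ (wetRegion R) :=
  uniqueDiffOn_wetRegion hw.differentiable_R

theorem depth_nonneg (hw : IsWave m R η u η₀ u₀) {p : ℝ × ℝ} (hp : p ∈ wetRegion R) :
    0 ≤ p.1 + η p := by
  obtain ⟨x, t⟩ := p
  rcases eq_or_lt_of_le hp.2 with h | h
  · simp only at h
    subst h
    simp [hw.shoreline t hp.1]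
  · exact (hw.wet x t hp.1 h).le

theorem mapsTo_cgt (hw : IsWave m R η u η₀ u₀) :
    MapsTo (cgt η u) (wetRegion R) hodographPlane := fun _ hp => hw.depth_nonneg hp

theorem hasFDerivWithinAt_cgt (hw : IsWave m R η u η₀ u₀) {p : ℝ × ℝ} (hp : p ∈ wetRegion R) :
    HasFDerivWithinAt (cgt η u)
      ((ContinuousLinearMap.fst ℝ ℝ ℝ + fderivWithin ℝ η (wetRegion R) p).prod
        (ContinuousLinearMap.snd ℝ ℝ ℝ - fderivWithin ℝ u (wetRegion R) p)) (wetRegion R) p :=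
  (hasFDerivWithinAt_fst.add (hw.smooth_η.hasFDerivWithinAt_of_mem hp)).prodMk
    (hasFDerivWithinAt_snd.sub (hw.smooth_u.hasFDerivWithinAt_of_mem hp))

theorem det_cgt (hw : IsWave m R η u η₀ u₀) {p : ℝ × ℝ} (hp : p ∈ wetRegion R) :
    (fderivWithin ℝ (cgt η u) (wetRegion R) p).det
      = (1 + d1 (wetRegion R) η p) ^ 2
        - m / (m + 1) * (p.1 + η p) * d1 (wetRegion R) u p ^ 2 := by
  rw [(hw.hasFDerivWithinAt_cgt hp).fderivWithin (hw.uniqueDiffOn p hp),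
    ContinuousLinearMap.det_prod_real]
  have h1 := hw.mass p hp
  have h2 := hw.momentum p hp
  simp only [d1, d2] at h1 h2 ⊢
  simp
  linear_combination fderivWithin ℝ u (wetRegion R) p (1, 0) * h1
    - (1 + fderivWithin ℝ η (wetRegion R) p (1, 0)) * h2

/-- On the shoreline the depth vanishes and the expression is a square. Being nonzero on a connected
set, it keeps that sign. -/
theorem det_cgt_pos (hw : IsWave m R η u η₀ u₀) (hinv : CGTInvertible R η u) {p : ℝ × ℝ}
    (hp : p ∈ wetRegion R) :
    0 < (1 + d1 (wetRegion R) η p) ^ 2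
        - m / (m + 1) * (p.1 + η p) * d1 (wetRegion R) u p ^ 2 := by
  have h0 : ∀ p ∈ wetRegion R, (1 + d1 (wetRegion R) η p) ^ 2
      - m / (m + 1) * (p.1 + η p) * d1 (wetRegion R) u p ^ 2 ≠ 0 := fun p hp => by
    rw [← hw.det_cgt hp]; exact hinv.jacobian p hp
  have hs := shoreline_mem_wetRegion R (le_refl (0 : ℝ))
  have c1 := hw.smooth_η.continuousOn
  have c2 := hw.smooth_η.continuousOn_d1 hw.uniqueDiffOn
  have c3 := hw.smooth_u.continuousOn_d1 hw.uniqueDiffOn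
  refine pos_of_isPreconnected (isPreconnected_wetRegion hw.differentiable_R.continuous)
    (f := fun p => (1 + d1 (wetRegion R) η p) ^ 2
      - m / (m + 1) * (p.1 + η p) * d1 (wetRegion R) u p ^ 2) ?_ h0 hs ?_ hp
  · fun_prop
  · have h := h0 _ hs
    simp only [hw.shoreline 0 le_rfl, neg_add_cancel, mul_zero, zero_mul, sub_zero] at h ⊢
    positivity

theorem hasDerivWithinAt_depth (hw : IsWave m R η u η₀ u₀) {x t : ℝ} (ht : 0 ≤ t)
    (hx : -R t ≤ x) :
    HasDerivWithinAt (fun x => x + η (x, t)) (1 + d1 (wetRegion R) η (x, t)) (Ici (-R t)) x := by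
  have h := hw.smooth_η.hasDerivWithinAt_comp_curve (I := Ici (-R t)) (x := fun r => r)
    (y := fun _ => t) (s := x) (hasDerivWithinAt_id x _) (hasDerivWithinAt_const x _ t)
    (fun r hr => ⟨ht, hr⟩) hx
  exact ((hasDerivWithinAt_id x (Ici (-R t))).add h).congr_deriv (by simp)

theorem one_add_d1_pos (hm : 0 < m) (hw : IsWave m R η u η₀ u₀) (hinv : CGTInvertible R η u)
    {p : ℝ × ℝ} (hp : p ∈ wetRegion R) : 0 < 1 + d1 (wetRegion R) η p := by
  have h0 : ∀ p ∈ wetRegion R, 1 + d1 (wetRegion R) η p ≠ 0 := fun p hp h => by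
    have h1 := hw.det_cgt_pos hinv hp
    have h2 : 0 ≤ m / (m + 1) * (p.1 + η p) * d1 (wetRegion R) u p ^ 2 :=
      mul_nonneg (mul_nonneg (by positivity) (hw.depth_nonneg hp)) (sq_nonneg _)
    rw [h] at h1
    linarith
  have hpre := isPreconnected_wetRegion hw.differentiable_R.continuous
  have hc : ContinuousOn (fun p => 1 + d1 (wetRegion R) η p) (wetRegion R) :=
    continuousOn_const.add (hw.smooth_η.continuousOn_d1 hw.uniqueDiffOn)
  by_contra hcon
  have hneg : 0 < -(1 + d1 (wetRegion R) η p) := by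
    have := lt_of_le_of_ne (not_lt.1 hcon) (h0 p hp)
    linarith
  have hall : ∀ q ∈ wetRegion R, 0 < -(1 + d1 (wetRegion R) η q) := fun q hq =>
    pos_of_isPreconnected hpre (f := fun p => -(1 + d1 (wetRegion R) η p)) hc.neg
      (fun q hq => neg_ne_zero.2 (h0 q hq)) hp hneg hq
  -- If the sign were negative, the depth at time zero would not increase from its shoreline value
  -- `0`, contradicting positivity offshore.
  have hanti : AntitoneOn (fun x => x + η (x, 0)) (Ici (-R 0)) :=
    antitoneOn_of_hasDerivWithinAt_nonpos (f' := fun x => 1 + d1 (wetRegion R) η (x, 0))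
      (convex_Ici _)
      (fun x hx => (hw.hasDerivWithinAt_depth le_rfl hx).continuousWithinAt)
      (fun x hx => (hw.hasDerivWithinAt_depth le_rfl (interior_subset hx)).mono interior_subset)
      (fun x hx => by
        have := hall (x, 0) ⟨le_rfl, interior_subset hx⟩
        linarith)
  have h1 := hanti (mem_Ici.2 (le_refl (-R 0))) (mem_Ici.2 (by linarith : -R 0 ≤ -R 0 + 1))
    (by linarith)
  have h2 := hw.wet (-R 0 + 1) 0 le_rfl (by linarith)
  simp only [hw.shoreline 0 le_rfl] at h1
  linarith

theorem strictMonoOn_depth (hm : 0 < m) (hw : IsWave m R η u η₀ u₀)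
    (hinv : CGTInvertible R η u) {t : ℝ} (ht : 0 ≤ t) :
    StrictMonoOn (fun x => x + η (x, t)) (Ici (-R t)) :=
  strictMonoOn_of_hasDerivWithinAt_pos (f' := fun x => 1 + d1 (wetRegion R) η (x, t))
    (convex_Ici _)
    (fun _ hx => (hw.hasDerivWithinAt_depth ht hx).continuousWithinAt)
    (fun _ hx => (hw.hasDerivWithinAt_depth ht (interior_subset hx)).mono interior_subset)
    (fun _ hx => hw.one_add_d1_pos hm hinv ⟨ht, interior_subset hx⟩)

/-- Differentiating `η (-R t, t) = R t` and using the mass equation at zero depth gives `(u + R') (1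
+ η_x) = 0`. -/
theorem shoreline_velocity (hm : 0 < m) (hw : IsWave m R η u η₀ u₀)
    (hinv : CGTInvertible R η u) {t : ℝ} (ht : 0 ≤ t) : u (-R t, t) = -deriv R t := by
  have hp := shoreline_mem_wetRegion R ht
  have hR := (hw.differentiable_R t).hasDerivAt.hasDerivWithinAt (s := Ici 0)
  have h := hw.smooth_η.hasDerivWithinAt_comp_curve (I := Ici 0) (x := fun r => -R r)
    (y := fun r => r) (s := t) hR.neg (hasDerivWithinAt_id t _)
    (fun r hr => shoreline_mem_wetRegion R hr) ht
  have h1 := (uniqueDiffOn_Ici (0 : ℝ) t ht).eq_deriv _ h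
    (hR.congr (fun r hr => hw.shoreline r hr) (hw.shoreline t ht))
  have h2 := hw.mass _ hp
  simp only [hw.shoreline t ht, neg_add_cancel, mul_zero, zero_mul, add_zero] at h2
  have h3 := (hw.one_add_d1_pos hm hinv hp).ne'
  refine mul_right_cancel₀ h3 ?_
  linear_combination h2 - h1

theorem cgt_shoreline (hm : 0 < m) (hw : IsWave m R η u η₀ u₀)
    (hinv : CGTInvertible R η u) {t : ℝ} (ht : 0 ≤ t) :
    cgt η u (-R t, t) = (0, t + deriv R t) := by
  simp [cgt, hw.shoreline t ht, hw.shoreline_velocity hm hinv ht]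

/-- The chain rule for the Carrier–Greenspan transformation. -/
theorem chain_rule (hw : IsWave m R η u η₀ u₀) {f g : ℝ × ℝ → ℝ}
    (hf : ContDiffOn ℝ 1 f hodographPlane) (hfg : ∀ p ∈ wetRegion R, f (cgt η u p) = g p)
    {p : ℝ × ℝ} (hp : p ∈ wetRegion R) :
    d1 (wetRegion R) g p = d1 hodographPlane f (cgt η u p) * (1 + d1 (wetRegion R) η p)
        - d2 hodographPlane f (cgt η u p) * d1 (wetRegion R) u p ∧
      d2 (wetRegion R) g p = d1 hodographPlane f (cgt η u p) * d2 (wetRegion R) η p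
        + d2 hodographPlane f (cgt η u p) * (1 - d2 (wetRegion R) u p) := by
  have h := ((hf.hasFDerivWithinAt_of_mem (hw.mapsTo_cgt hp)).comp p (hw.hasFDerivWithinAt_cgt hp)
    hw.mapsTo_cgt).congr (fun q hq => (hfg q hq).symm) (hfg p hp).symm
  have h1 := h.fderivWithin (hw.uniqueDiffOn p hp)
  constructor
  · rw [d1, h1]
    simp only [ContinuousLinearMap.comp_apply, ContinuousLinearMap.prod_apply,
      add_apply, sub_apply, ContinuousLinearMap.coe_fst',
      ContinuousLinearMap.coe_snd', fderivWithin_apply_eq]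
    ring
  · rw [d2, h1]
    simp only [ContinuousLinearMap.comp_apply, ContinuousLinearMap.prod_apply,
      add_apply, sub_apply, ContinuousLinearMap.coe_fst',
      ContinuousLinearMap.coe_snd', fderivWithin_apply_eq]
    ring

end IsWave

/-! ### Inverse functions on rays and roots of `τ = -φ(σ, τ)` -/

theorem exists_continuousOn_inverse_Ici {f : ℝ → ℝ} {a : ℝ} (hf : StrictMonoOn f (Ici a))
    (hc : ContinuousOn f (Ici a)) (htop : Tendsto f atTop atTop) :
    ∃ X : ℝ → ℝ, ContinuousOn X (Ici (f a)) ∧ BijOn X (Ici (f a)) (Ici a) ∧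
      (∀ y, f a ≤ y → f (X y) = y) ∧ ∀ x, a ≤ x → X (f x) = x := by
  have hsurj : ∀ y : ℝ, ∃ x : ℝ, f a ≤ y → a ≤ x ∧ f x = y := fun y => by
    by_cases hy : f a ≤ y
    · obtain ⟨x, hx, hxy⟩ := intermediate_value_Ici hc htop hy
      exact ⟨x, fun _ => ⟨hx, hxy⟩⟩
    · exact ⟨0, fun h => absurd h hy⟩
  choose X hX using hsurj
  have hmaps : ∀ x, a ≤ x → f a ≤ f x := fun x hx => hf.monotoneOn (mem_Ici.2 le_rfl) hx hx
  have hleft : ∀ x, a ≤ x → X (f x) = x := fun x hx =>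
    hf.injOn (hX _ (hmaps x hx)).1 hx (hX _ (hmaps x hx)).2
  have hmono : ∀ y z, f a ≤ y → y ≤ z → X y ≤ X z := fun y z hy hyz => by
    have h1 := hX y hy
    have h2 := hX z (hy.trans hyz)
    rw [← hf.le_iff_le h1.1 h2.1, h1.2, h2.2]
    exact hyz
  refine ⟨X, ?_, ⟨fun y hy => (hX y hy).1, fun y hy z hz h => ?_, fun x hx =>
    ⟨f x, hmaps x hx, hleft x hx⟩⟩, fun y hy => (hX y hy).2, hleft⟩
  · rw [continuousOn_iff_continuous_domRestrict]
    -- The inverse is monotone and onto the ray, hence has no jumps.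
    have h : Continuous fun y : Ici (f a) => (⟨X y, (hX y y.2).1⟩ : Ici a) :=
      Monotone.continuous_of_surjective (fun y z hyz => hmono y z y.2 hyz)
        fun x => ⟨⟨f x, hmaps x x.2⟩, Subtype.ext (hleft x x.2)⟩
    exact continuous_subtype_val.comp h
  · rw [← (hX y hy).2, ← (hX z hz).2, h]

theorem IsHodographSolution.det_cgtInv {m : ℝ} {ψ φ : ℝ × ℝ → ℝ} (h : IsHodographSolution m ψ φ)
    {p : ℝ × ℝ} (hp : p ∈ hodographPlane) :
    (fderivWithin ℝ (cgtInv ψ φ) hodographPlane p).det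
      = (1 + d2 hodographPlane φ p) ^ 2 - m / (m + 1) * p.1 * d1 hodographPlane φ p ^ 2 := by
  have hψ := h.smooth_ψ.hasFDerivWithinAt_of_mem hp
  have hφ := h.smooth_φ.hasFDerivWithinAt_of_mem hp
  have hd : HasFDerivWithinAt (cgtInv ψ φ)
      ((ContinuousLinearMap.fst ℝ ℝ ℝ - fderivWithin ℝ ψ hodographPlane p
        + φ p • fderivWithin ℝ φ hodographPlane p).prod
        (ContinuousLinearMap.snd ℝ ℝ ℝ + fderivWithin ℝ φ hodographPlane p)) hodographPlane p := by
    have h2 : HasFDerivWithinAt (fun q => φ q ^ 2 / 2)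
        (φ p • fderivWithin ℝ φ hodographPlane p) hodographPlane p := by
      have h3 := (hφ.pow 2).const_mul (1 / 2)
      refine (h3.congr_fderiv ?_).congr (fun q _ => ?_) ?_
      · ext <;> simp <;> ring
      · ring
      · ring
    exact ((hasFDerivWithinAt_fst.sub hψ).add h2).prodMk (hasFDerivWithinAt_snd.add hφ)
  rw [hd.fderivWithin (uniqueDiffOn_hodographPlane p hp), ContinuousLinearMap.det_prod_real]
  obtain ⟨h1, h2⟩ := h.system p hp
  simp only [d1, d2] at h1 h2 ⊢
  simp
  linear_combination -(1 + fderivWithin ℝ φ hodographPlane p (0, 1)) * h2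
    + fderivWithin ℝ φ hodographPlane p (1, 0) * h1

theorem ContDiffOn.strictMonoOn_add_snd {φ : ℝ × ℝ → ℝ} (hφ : ContDiffOn ℝ 1 φ hodographPlane)
    {σ : ℝ} (hσ : 0 ≤ σ) {D : Set ℝ} (hD : Convex ℝ D)
    (hpos : ∀ τ ∈ D, 0 < 1 + d2 hodographPlane φ (σ, τ)) :
    StrictMonoOn (fun τ => τ + φ (σ, τ)) D := by
  have hd : ∀ τ, HasDerivAt (fun τ => τ + φ (σ, τ)) (1 + d2 hodographPlane φ (σ, τ)) τ :=
    fun τ => (hasDerivAt_id τ).add (hφ.hasDerivAt_snd_of_hodographPlane hσ τ)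
  exact strictMonoOn_of_hasDerivWithinAt_pos hD (fun τ _ => (hd τ).continuousAt.continuousWithinAt)
    (fun τ _ => (hd τ).hasDerivWithinAt) (fun τ hτ => hpos τ (interior_subset hτ))

/-- The Jacobian `(1 + φ_τ)² - c σ φ_σ²` is nonnegative at `σ = 0`, hence positive everywhere. So `1
+ φ_τ` never vanishes, keeps its sign from `(0, a)`, and `τ + φ` is strictly increasing on each
vertical line. -/
theorem IsHodographSolution.root_unique {m : ℝ} {ψ φ : ℝ × ℝ → ℝ} (hm : 0 < m)
    (h : IsHodographSolution m ψ φ)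
    (hdet : ∀ p ∈ hodographPlane, (fderivWithin ℝ (cgtInv ψ φ) hodographPlane p).det ≠ 0)
    {a : ℝ} (ha : 0 < 1 + d2 hodographPlane φ (0, a)) {σ τ τ' : ℝ} (hσ : 0 ≤ σ)
    (hτ : τ = -φ (σ, τ)) (hτ' : τ' = -φ (σ, τ')) : τ = τ' := by
  have c0 := h.smooth_φ.continuousOn
  have c1 := h.smooth_φ.continuousOn_d1 uniqueDiffOn_hodographPlane
  have c2 := h.smooth_φ.continuousOn_d2 uniqueDiffOn_hodographPlane
  have h00 : ((0 : ℝ), a) ∈ hodographPlane := le_refl (0 : ℝ)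
  have hJ : ∀ p ∈ hodographPlane, 0 < (1 + d2 hodographPlane φ p) ^ 2
      - m / (m + 1) * p.1 * d1 hodographPlane φ p ^ 2 := fun p hp => by
    refine pos_of_isPreconnected isPreconnected_hodographPlane
      (f := fun p : ℝ × ℝ => (1 + d2 hodographPlane φ p) ^ 2
        - m / (m + 1) * p.1 * d1 hodographPlane φ p ^ 2) (by fun_prop)
      (fun p hp => by rw [← h.det_cgtInv hp]; exact hdet p hp) h00 ?_ hp
    simp only [mul_zero, zero_mul, sub_zero]
    positivity
  have hpos : ∀ p ∈ hodographPlane, 0 < 1 + d2 hodographPlane φ p := fun p hp => by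
    refine pos_of_isPreconnected isPreconnected_hodographPlane
      (f := fun p : ℝ × ℝ => 1 + d2 hodographPlane φ p) (by fun_prop)
      (fun p hp h0 => ?_) h00 ha hp
    have h1 := hJ p hp
    have h2 : 0 ≤ m / (m + 1) * p.1 * d1 hodographPlane φ p ^ 2 :=
      mul_nonneg (mul_nonneg (by positivity) hp) (sq_nonneg _)
    rw [h0] at h1
    linarith
  refine (h.smooth_φ.strictMonoOn_add_snd hσ convex_univ fun τ _ => hpos _ hσ).injOn
    (mem_univ τ) (mem_univ τ') ?_
  show τ + φ (σ, τ) = τ' + φ (σ, τ')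
  linarith

/-- A continuous curve of roots along which `τ + φ` has positive `τ`-derivative is determined by
its starting point. -/
theorem eqOn_of_continuous_roots {φ : ℝ × ℝ → ℝ} (hφ : ContDiffOn ℝ 1 φ hodographPlane)
    {γ γ' : ℝ → ℝ} (hγ : ContinuousOn γ (Ici 0)) (hγ' : ContinuousOn γ' (Ici 0))
    (h0 : γ' 0 = γ 0) (hr : ∀ σ, 0 ≤ σ → γ σ = -φ (σ, γ σ))
    (hr' : ∀ σ, 0 ≤ σ → γ' σ = -φ (σ, γ' σ))
    (hpos : ∀ σ, 0 ≤ σ → 0 < 1 + d2 hodographPlane φ (σ, γ σ)) : EqOn γ' γ (Ici 0) := by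
  intro b hb
  have key : Icc 0 b ⊆ {σ | γ' σ = γ σ} := by
    -- Continuous induction on `[0, b]`: the agreement set is closed, and strict monotonicity of `τ
    -- + φ` near a common point extends it to the right.
    refine IsClosed.Icc_subset_of_forall_mem_nhdsWithin ?_ h0 ?_
    · have h := ContinuousOn.preimage_isClosed_of_isClosed
        (f := fun σ => γ' σ - γ σ) (s := Icc 0 b) (t := {0})
        ((hγ'.sub hγ).mono Icc_subset_Ici_self) isClosed_Icc isClosed_singleton
      convert h using 1
      ext σ
      simp [sub_eq_zero, and_comm]
    · rintro σ₀ ⟨heq, hσ₀, -⟩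
      have heq : γ' σ₀ = γ σ₀ := heq
      have hc2 := hφ.continuousOn_d2 uniqueDiffOn_hodographPlane
      have hev : ∀ᶠ p in 𝓝[hodographPlane] (σ₀, γ σ₀), 0 < 1 + d2 hodographPlane φ p :=
        (continuousWithinAt_const.add (hc2 (σ₀, γ σ₀) hσ₀)).eventually
          (lt_mem_nhds (hpos σ₀ hσ₀))
      obtain ⟨δ, hδ, hball⟩ := Metric.mem_nhdsWithin_iff.1 hev
      have hle : 𝓝[>] σ₀ ≤ 𝓝[Ici 0] σ₀ :=
        nhdsWithin_mono σ₀ fun σ (hσ : σ₀ < σ) => mem_Ici.2 (hσ₀.trans hσ.le)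
      have e1 : ∀ᶠ σ in 𝓝[>] σ₀, dist (γ σ) (γ σ₀) < δ :=
        hle ((hγ σ₀ hσ₀).eventually (Metric.ball_mem_nhds _ hδ))
      have e2 : ∀ᶠ σ in 𝓝[>] σ₀, dist (γ' σ) (γ σ₀) < δ := by
        have := (hγ' σ₀ hσ₀).eventually (Metric.ball_mem_nhds _ hδ)
        rw [heq] at this
        exact hle this
      have e3 : ∀ᶠ σ in 𝓝[>] σ₀, dist σ σ₀ < δ :=
        nhdsWithin_le_nhds (Metric.ball_mem_nhds σ₀ hδ)
      filter_upwards [e1, e2, e3, self_mem_nhdsWithin] with σ d1 d2 d3 hσ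
      have hσ0 : 0 ≤ σ := hσ₀.trans (le_of_lt hσ)
      refine (hφ.strictMonoOn_add_snd hσ0 (convex_ball (γ σ₀) δ) fun τ hτ => ?_).injOn d2 d1 ?_
      · exact hball ⟨by rw [Metric.mem_ball, Prod.dist_eq]; exact max_lt d3 hτ, hσ0⟩
      · show γ' σ + φ (σ, γ' σ) = γ σ + φ (σ, γ σ)
        linarith [hr σ hσ0, hr' σ hσ0]
  exact key ⟨hb, le_rfl⟩

/-! ### The hodograph pair of a wave -/

namespace IsHodographPair

variable {m : ℝ} {R : ℝ → ℝ} {η u ψ φ : ℝ × ℝ → ℝ} {η₀ u₀ : ℝ → ℝ}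

/-- Off the image of the wet region the system is assumed. On it, each linear equation multiplied by
the Jacobian is a combination of the chain rule and the shallow water equations, and the Jacobian is
nonzero. -/
theorem isHodographSolution (h : IsHodographPair m R η u ψ φ) (hw : IsWave m R η u η₀ u₀)
    (hinv : CGTInvertible R η u) : IsHodographSolution m ψ φ := by
  refine ⟨h.smooth_ψ, h.smooth_φ, fun q hq => ?_⟩
  by_cases hmem : q ∈ cgt η u '' wetRegion R
  swap
  · exact h.continuation q hq hmem
  obtain ⟨p, hp, rfl⟩ := hmem
  obtain ⟨ev, ew⟩ := hw.chain_rule h.smooth_φ h.velocity hp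
  obtain ⟨ea, eb⟩ := hw.chain_rule h.smooth_ψ h.pressure hp
  have hd : HasFDerivWithinAt (fun p => η p + u p ^ 2 / 2) (fderivWithin ℝ η (wetRegion R) p
      + u p • fderivWithin ℝ u (wetRegion R) p) (wetRegion R) p := by
    have h3 := ((hw.smooth_u.hasFDerivWithinAt_of_mem hp).pow 2).const_mul (1 / 2)
    refine (hw.smooth_η.hasFDerivWithinAt_of_mem hp).add
      ((h3.congr_fderiv ?_).congr (fun q _ => ?_) ?_)
    · ext <;> simp <;> ring
    · ring
    · ring
  have hfd := hd.fderivWithin (hw.uniqueDiffOn p hp)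
  have e1 : d1 (wetRegion R) (fun p => η p + u p ^ 2 / 2) p
      = d1 (wetRegion R) η p + u p * d1 (wetRegion R) u p := by
    simp [d1, hfd]
  have e2 : d2 (wetRegion R) (fun p => η p + u p ^ 2 / 2) p
      = d2 (wetRegion R) η p + u p * d2 (wetRegion R) u p := by
    simp [d2, hfd]
  rw [e1] at ea
  rw [e2] at eb
  have hM := hw.mass p hp
  have hP := hw.momentum p hp
  have hJ : (1 + d1 (wetRegion R) η p) * (1 - d2 (wetRegion R) u p)
      + d1 (wetRegion R) u p * d2 (wetRegion R) η p ≠ 0 := by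
    have := (hw.det_cgt_pos hinv hp).ne'
    intro h0
    apply this
    linear_combination h0 - d1 (wetRegion R) u p * hM + (1 + d1 (wetRegion R) η p) * hP
  rw [HodographSystemAt, h.velocity p hp]
  have hσ : (cgt η u p).1 = p.1 + η p := rfl
  rw [hσ]
  generalize d1 hodographPlane φ (cgt η u p) = A at *
  generalize d2 hodographPlane φ (cgt η u p) = B at *
  generalize d1 hodographPlane ψ (cgt η u p) = C at *
  generalize d2 hodographPlane ψ (cgt η u p) = D at *
  generalize d1 (wetRegion R) η p = a at *
  generalize d2 (wetRegion R) η p = b at *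
  generalize d1 (wetRegion R) u p = v at *
  generalize d2 (wetRegion R) u p = w at *
  constructor
  · refine (mul_eq_zero.1 (?_ : ((1 + a) * (1 - w) + v * b) * _ = 0)).resolve_left hJ
    linear_combination hM - (1 + a) * eb + b * ea
      - m / (m + 1) * (p.1 + η p) * ((1 - w) * ev + v * ew)
  · refine (mul_eq_zero.1 (?_ : ((1 + a) * (1 - w) + v * b) * _ = 0)).resolve_left hJ
    linear_combination hP - (1 + a) * ew + b * ev - (1 - w) * ea - v * eb

/-- `1 + φ_τ` is the entry `∂t/∂τ` of the inverse derivative, so its product with the Jacobian is `1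
+ η_x`. -/
theorem one_add_d2_pos (hm : 0 < m) (h : IsHodographPair m R η u ψ φ)
    (hw : IsWave m R η u η₀ u₀) (hinv : CGTInvertible R η u) {p : ℝ × ℝ}
    (hp : p ∈ wetRegion R) : 0 < 1 + d2 hodographPlane φ (cgt η u p) := by
  obtain ⟨ev, ew⟩ := hw.chain_rule h.smooth_φ h.velocity hp
  have hM := hw.mass p hp
  have hP := hw.momentum p hp
  have hJ := hw.det_cgt_pos hinv hp
  have ha := hw.one_add_d1_pos hm hinv hp
  refine pos_of_mul_pos_right (a := (1 + d1 (wetRegion R) η p) ^ 2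
    - m / (m + 1) * (p.1 + η p) * d1 (wetRegion R) u p ^ 2) ?_ hJ.le
  have : ((1 + d1 (wetRegion R) η p) ^ 2
    - m / (m + 1) * (p.1 + η p) * d1 (wetRegion R) u p ^ 2)
      * (1 + d2 hodographPlane φ (cgt η u p)) = 1 + d1 (wetRegion R) η p := by
    linear_combination (1 + d2 hodographPlane φ (cgt η u p)) *
      ((1 + d1 (wetRegion R) η p) * hP - d1 (wetRegion R) u p * hM)
      - (1 + d1 (wetRegion R) η p) * ew + d2 (wetRegion R) η p * ev
  rw [this]
  exact ha

theorem shoreline_of_nonneg (hm : 0 < m) (h : IsHodographPair m R η u ψ φ)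
    (hw : IsWave m R η u η₀ u₀) (hinv : CGTInvertible R η u) {t : ℝ} (ht : 0 ≤ t) :
    ψ (0, t + deriv R t) = R t + deriv R t ^ 2 / 2 ∧ φ (0, t + deriv R t) = -deriv R t := by
  have hp := shoreline_mem_wetRegion R ht
  rw [← hw.cgt_shoreline hm hinv ht, h.velocity _ hp, h.pressure _ hp,
    hw.shoreline_velocity hm hinv ht, hw.shoreline t ht]
  simp

theorem analytic_velocity (h : IsHodographPair m R η u ψ φ) (hw : IsWave m R η u η₀ u₀)
    (hinv : CGTInvertible R η u) : AnalyticOnNhd ℝ (fun τ => φ (0, τ)) univ := by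
  simp only [(h.isHodographSolution hw hinv).shoreline_velocity]
  exact h.analytic_shoreline.deriv.neg

/-- Both sides are analytic in `t` and agree for `t ≥ 0`, hence near `t = 1`, and so everywhere. -/
theorem shoreline (hm : 0 < m) (h : IsHodographPair m R η u ψ φ)
    (hw : IsWave m R η u η₀ u₀) (hinv : CGTInvertible R η u) (t : ℝ) :
    ψ (0, t + deriv R t) = R t + deriv R t ^ 2 / 2 ∧ φ (0, t + deriv R t) = -deriv R t := by
  have hR := hw.analytic_R
  have hin : AnalyticOnNhd ℝ (fun t => t + deriv R t) univ := analyticOnNhd_id.add hR.deriv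
  have hpos : ∀ᶠ t : ℝ in 𝓝 1, 0 ≤ t := (lt_mem_nhds one_pos).mono fun _ => le_of_lt
  constructor
  · have h1 : AnalyticOnNhd ℝ (fun t => ψ (0, t + deriv R t)) univ :=
      h.analytic_shoreline.comp hin (mapsTo_univ _ _)
    have h2 : AnalyticOnNhd ℝ (fun t => R t + deriv R t ^ 2 / 2) univ :=
      hR.add ((hR.deriv.pow 2).div_const)
    exact congrFun (h1.eq_of_eventuallyEq h2 (z₀ := 1)
      (hpos.mono fun t ht => (h.shoreline_of_nonneg hm hw hinv ht).1)) t
  · have h1 : AnalyticOnNhd ℝ (fun t => φ (0, t + deriv R t)) univ :=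
      (h.analytic_velocity hw hinv).comp hin (mapsTo_univ _ _)
    exact congrFun (h1.eq_of_eventuallyEq hR.deriv.neg (z₀ := 1)
      (hpos.mono fun t ht => (h.shoreline_of_nonneg hm hw hinv ht).2)) t

end IsHodographPair

/-- Analytic functions that agree at the shoreline points of a wave agree. -/
theorem eq_of_eq_on_shoreline {m : ℝ} {R : ℝ → ℝ} {η u : ℝ × ℝ → ℝ} {η₀ u₀ : ℝ → ℝ}
    (hm : 0 < m) (hw : IsWave m R η u η₀ u₀) (hinv : CGTInvertible R η u) {f g : ℝ → ℝ}
    (hf : AnalyticOnNhd ℝ f univ) (hg : AnalyticOnNhd ℝ g univ)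
    (hfg : ∀ t, 0 ≤ t → f (t + deriv R t) = g (t + deriv R t)) : f = g := by
  set k : ℝ → ℝ := fun t => t + deriv R t with hk
  have hkc : Continuous k :=
    continuous_id.add (continuousOn_univ.1 hw.analytic_R.deriv.continuousOn)
  -- Injectivity of the transformation on the shoreline makes `k` nonconstant on `[0, 1]`, so its
  -- values fill a nontrivial interval for the identity theorem.
  have hne : k 0 ≠ k 1 := fun h => by
    have h1 := hinv.injOn (shoreline_mem_wetRegion R le_rfl)
      (shoreline_mem_wetRegion R zero_le_one) (by
        rw [hw.cgt_shoreline hm hinv le_rfl, hw.cgt_shoreline hm hinv zero_le_one]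
        exact congrArg (Prod.mk (0 : ℝ)) h)
    exact zero_ne_one (congrArg Prod.snd h1)
  have hsub : ∀ τ ∈ uIcc (k 0) (k 1), f τ = g τ := fun τ hτ => by
    obtain ⟨t, ht, rfl⟩ := intermediate_value_uIcc hkc.continuousOn hτ
    rw [uIcc_of_le zero_le_one] at ht
    exact hfg t ht.1
  have hlt : min (k 0) (k 1) < max (k 0) (k 1) := min_lt_max.2 hne
  obtain ⟨z, hz⟩ := exists_between hlt
  exact hf.eq_of_eventuallyEq hg (z₀ := z) (by
    filter_upwards [Ioo_mem_nhds hz.1 hz.2] with τ hτ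
    exact hsub τ (Ioo_subset_Icc_self hτ))

/-- The image of `t = 0` in the hodograph plane and the physical initial data. -/
theorem IsHodographPair.exists_initialCurve {m : ℝ} {R : ℝ → ℝ} {η u ψ φ : ℝ × ℝ → ℝ}
    {η₀ u₀ : ℝ → ℝ} (hm : 0 < m) (h : IsHodographPair m R η u ψ φ)
    (hw : IsWave m R η u η₀ u₀) (hinv : CGTInvertible R η u) :
    ∃ γ : ℝ → ℝ, IsInitialCurve R φ γ ∧
      (∀ γ' : ℝ → ℝ, IsInitialCurve R φ γ' → EqOn γ' γ (Ici 0)) ∧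
      (∀ x : ℝ, -R 0 ≤ x → γ (x + η₀ x) = -u₀ x) ∧
      BijOn (fun σ => σ - ψ (σ, γ σ) + φ (σ, γ σ) ^ 2 / 2) (Ici 0) (Ici (-R 0)) ∧
      ∀ σ : ℝ, 0 ≤ σ →
        η₀ (σ - ψ (σ, γ σ) + φ (σ, γ σ) ^ 2 / 2) = ψ (σ, γ σ) - φ (σ, γ σ) ^ 2 / 2 ∧
        u₀ (σ - ψ (σ, γ σ) + φ (σ, γ σ) ^ 2 / 2) = φ (σ, γ σ) := by
  have hmem : ∀ x, -R 0 ≤ x → (x, (0 : ℝ)) ∈ wetRegion R := fun x hx => ⟨le_rfl, hx⟩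
  have htop : Tendsto (fun x => x + η (x, 0)) atTop atTop := by
    refine hw.offshore.congr' ?_
    filter_upwards [eventually_ge_atTop (-R 0)] with x hx
    rw [hw.initial_η x hx]
  -- `X` inverts the depth at time zero; unbounded offshore depth makes it defined for every `σ ≥
  -- 0`.
  obtain ⟨X, hXc, hXb, hX, hX'⟩ := exists_continuousOn_inverse_Ici
    (hw.strictMonoOn_depth hm hinv le_rfl)
    (fun x hx => (hw.hasDerivWithinAt_depth le_rfl hx).continuousWithinAt) htop
  have h0 : -R 0 + η (-R 0, 0) = 0 := by rw [hw.shoreline 0 le_rfl, neg_add_cancel]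
  rw [h0] at hXc hXb hX
  have hXm : ∀ σ, 0 ≤ σ → (X σ, (0 : ℝ)) ∈ wetRegion R := fun σ hσ => hmem _ (hXb.mapsTo hσ)
  -- At `t = 0` the coordinate `τ = t - u` equals `-u`.
  obtain ⟨γ, hγ⟩ : ∃ γ : ℝ → ℝ, ∀ σ, γ σ = -u (X σ, 0) := ⟨_, fun _ => rfl⟩
  have hcgt : ∀ σ, 0 ≤ σ → cgt η u (X σ, 0) = (σ, γ σ) := fun σ hσ => by
    simp [cgt, hγ, hX σ hσ]
  have hφ : ∀ σ, 0 ≤ σ → φ (σ, γ σ) = u (X σ, 0) := fun σ hσ => by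
    rw [← hcgt σ hσ, h.velocity _ (hXm σ hσ)]
  have hψ : ∀ σ, 0 ≤ σ → ψ (σ, γ σ) = η (X σ, 0) + u (X σ, 0) ^ 2 / 2 := fun σ hσ => by
    rw [← hcgt σ hσ, h.pressure _ (hXm σ hσ)]
  have hx : ∀ σ, 0 ≤ σ → σ - ψ (σ, γ σ) + φ (σ, γ σ) ^ 2 / 2 = X σ := fun σ hσ => by
    rw [hφ σ hσ, hψ σ hσ]
    linarith [hX σ hσ]
  have hcurve : IsInitialCurve R φ γ := by
    refine ⟨?_, ?_, fun σ hσ => by rw [hφ σ hσ, hγ]⟩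
    · simp only [funext hγ]
      exact (hw.smooth_u.continuousOn.comp (hXc.prodMk continuousOn_const) hXm).neg
    · have hX0 : X 0 = -R 0 := by rw [← hX' (-R 0) le_rfl, h0]
      rw [hγ, hX0, hw.shoreline_velocity hm hinv le_rfl, neg_neg]
  refine ⟨γ, hcurve, fun γ' hγ' => ?_, fun x hx => ?_, ?_, fun σ hσ => ?_⟩
  · refine eqOn_of_continuous_roots h.smooth_φ hcurve.continuousOn hγ'.continuousOn
      (hγ'.start.trans hcurve.start.symm) hcurve.equation hγ'.equation fun σ hσ => ?_
    rw [← hcgt σ hσ]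
    exact h.one_add_d2_pos hm hw hinv (hXm σ hσ)
  · rw [← hw.initial_η x hx, hγ, hX' x hx, hw.initial_u x hx]
  · exact hXb.congr fun σ hσ => (hx σ hσ).symm
  · have hXR := hXb.mapsTo hσ
    rw [hx σ hσ, ← hw.initial_η _ hXR, ← hw.initial_u _ hXR, hφ σ hσ, hψ σ hσ]
    exact ⟨by ring, rfl⟩

end

/-! ### The inversion theorem -/

theorem mainTheorem3 (m : ℝ) (hm : 0 < m) (R : ℝ → ℝ) (η u : ℝ × ℝ → ℝ) (η₀ u₀ : ℝ → ℝ)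
    (hwave : IsWave m R η u η₀ u₀) (hinv : CGTInvertible R η u)
    (ψ φ : ℝ × ℝ → ℝ) (hpair : IsHodographPair m R η u ψ φ) :
    -- the pair solves the linear system in the whole half-plane
    IsHodographSolution m ψ φ ∧
    -- the shoreline pressure and velocity are read off from `R`, and are determined by it
    (∀ t : ℝ, ψ (0, t + deriv R t) = R t + deriv R t ^ 2 / 2 ∧
      φ (0, t + deriv R t) = -deriv R t) ∧
    (∀ g f : ℝ → ℝ, AnalyticOnNhd ℝ g Set.univ → AnalyticOnNhd ℝ f Set.univ →
      (∀ t : ℝ, 0 ≤ t → g (t + deriv R t) = R t + deriv R t ^ 2 / 2 ∧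
        f (t + deriv R t) = -deriv R t) →
      ∀ τ : ℝ, ψ (0, τ) = g τ ∧ φ (0, τ) = f τ) ∧
    -- the inversion formulas
    (∀ l : ℝ, 0 < l →
      (IntervalIntegrable (abelPsiIntegrand m (fun τ => ψ (0, τ)) l) MeasureTheory.volume
          0 (l / Real.pi) ∧
        ψ (l ^ 2, 0) = abelPsi m (fun τ => ψ (0, τ)) l) ∧
      (IntervalIntegrable (abelPhiIntegrand m (fun τ => φ (0, τ)) l) MeasureTheory.volume
          0 (l / Real.pi) ∧
        φ (l ^ 2, 0) = abelPhi m (fun τ => φ (0, τ)) l)) ∧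
    -- `(ψ, φ)` is the only solution with these data at `τ = 0`, and these are precisely the data
    -- that produce the observed shoreline pressure
    (∀ ψ' φ' : ℝ × ℝ → ℝ, IsHodographSolution m ψ' φ' →
      ((∀ l : ℝ, 0 < l → ψ' (l ^ 2, 0) = abelPsi m (fun τ => ψ (0, τ)) l ∧
          φ' (l ^ 2, 0) = abelPhi m (fun τ => φ (0, τ)) l) →
        Set.EqOn ψ' ψ hodographPlane ∧ Set.EqOn φ' φ hodographPlane) ∧
      ((∀ l : ℝ, 0 < l → ψ' (l ^ 2, 0) = abelPsi m (fun τ => ψ (0, τ)) l ∧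
          φ' (l ^ 2, 0) = abelPhi m (fun τ => φ (0, τ)) l) ↔
        ∀ τ : ℝ, ψ' (0, τ) = ψ (0, τ))) ∧
    -- the curve and the physical initial data
    (∃ γ : ℝ → ℝ, IsInitialCurve R φ γ ∧
      (∀ γ' : ℝ → ℝ, IsInitialCurve R φ γ' → Set.EqOn γ' γ (Set.Ici 0)) ∧
      ((∀ p ∈ hodographPlane, (fderivWithin ℝ (cgtInv ψ φ) hodographPlane p).det ≠ 0) →
        ∀ σ τ : ℝ, 0 ≤ σ → τ = -φ (σ, τ) → τ = γ σ) ∧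
      (∀ x : ℝ, -R 0 ≤ x → γ (x + η₀ x) = -u₀ x) ∧
      Set.BijOn (fun σ => σ - ψ (σ, γ σ) + φ (σ, γ σ) ^ 2 / 2) (Set.Ici 0) (Set.Ici (-R 0)) ∧
      (∀ σ : ℝ, 0 ≤ σ →
        η₀ (σ - ψ (σ, γ σ) + φ (σ, γ σ) ^ 2 / 2) = ψ (σ, γ σ) - φ (σ, γ σ) ^ 2 / 2 ∧
        u₀ (σ - ψ (σ, γ σ) + φ (σ, γ σ) ^ 2 / 2) = φ (σ, γ σ))) ∧
    -- uniqueness: waves with the same shoreline motion have the same initial data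
    (∀ (R' : ℝ → ℝ) (η' u' : ℝ × ℝ → ℝ) (η₀' u₀' : ℝ → ℝ), IsWave m R' η' u' η₀' u₀' →
      CGTInvertible R' η' u' → (∃ ψ' φ' : ℝ × ℝ → ℝ, IsHodographPair m R' η' u' ψ' φ') →
      (∀ t : ℝ, 0 ≤ t → R' t = R t) →
      ∀ x : ℝ, -R 0 ≤ x → η₀' x = η₀ x ∧ u₀' x = u₀ x) := by
  have hsol := hpair.isHodographSolution hwave hinv
  have hψa := hpair.analytic_shoreline
  have hφa := hpair.analytic_velocity hwave hinv
  obtain ⟨γ, hγ, hγu, hγx, hbij, hdata⟩ := hpair.exists_initialCurve hm hwave hinv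
  have hinversion := fun (l : ℝ) (hl : 0 < l) => hsol.inversion hm hψa hl
  refine ⟨hsol, hpair.shoreline hm hwave hinv, fun g f hg hf hgf τ => ⟨?_, ?_⟩,
    hinversion, fun ψ' φ' h' => ?_,
    ⟨γ, hγ, hγu, fun hdet σ τ hσ hτ => ?_, hγx, hbij, hdata⟩, ?_⟩
  · exact congrFun (eq_of_eq_on_shoreline hm hwave hinv hψa hg fun t ht =>
      (hpair.shoreline hm hwave hinv t).1.trans (hgf t ht).1.symm) τ
  · exact congrFun (eq_of_eq_on_shoreline hm hwave hinv hφa hf fun t ht =>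
      (hpair.shoreline hm hwave hinv t).2.trans (hgf t ht).2.symm) τ
  · have huniq : (∀ l : ℝ, 0 < l → ψ' (l ^ 2, 0) = abelPsi m (fun τ => ψ (0, τ)) l ∧
        φ' (l ^ 2, 0) = abelPhi m (fun τ => φ (0, τ)) l) →
        Set.EqOn ψ' ψ hodographPlane ∧ Set.EqOn φ' φ hodographPlane := fun h0 =>
      hsol.eqOn_of_initial hm h' fun l hl =>
        ⟨(h0 l hl).1.trans (hinversion l hl).1.2.symm,
          (h0 l hl).2.trans (hinversion l hl).2.2.symm⟩
    refine ⟨huniq, fun h0 τ => (huniq h0).1 (le_refl (0 : ℝ)), fun h0 l hl => ?_⟩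
    obtain ⟨e1, e2⟩ := hsol.eqOn_of_shoreline hm h' h0
    have hl2 : (l ^ 2, (0 : ℝ)) ∈ hodographPlane := sq_nonneg l
    exact ⟨(e1 hl2).trans (hinversion l hl).1.2, (e2 hl2).trans (hinversion l hl).2.2⟩
  · have ha := hpair.one_add_d2_pos hm hwave hinv (shoreline_mem_wetRegion R (le_refl (0 : ℝ)))
    rw [hwave.cgt_shoreline hm hinv le_rfl] at ha
    exact hsol.root_unique hm hdet ha hσ hτ (hγ.equation σ hσ)
  · rintro R' η' u' η₀' u₀' hwave' hinv' ⟨ψ', φ', hpair'⟩ hR x hx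
    -- Agreement for `t ≥ 0` extends to all times by analyticity, so a single `R` serves both waves.
    obtain rfl : R' = R := hwave'.analytic_R.eq_of_eventuallyEq hwave.analytic_R (z₀ := 1)
      ((lt_mem_nhds one_pos).mono fun t ht => hR t (le_of_lt ht))
    have h0 : (fun τ => ψ' (0, τ)) = fun τ => ψ (0, τ) :=
      eq_of_eq_on_shoreline hm hwave hinv hpair'.analytic_shoreline hψa fun t ht =>
        (hpair'.shoreline hm hwave' hinv' t).1.trans (hpair.shoreline hm hwave hinv t).1.symm
    obtain ⟨e1, e2⟩ := hsol.eqOn_of_shoreline hm (hpair'.isHodographSolution hwave' hinv')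
      fun τ => congrFun h0 τ
    obtain ⟨γ', hγ', -, -, -, hdata'⟩ := hpair'.exists_initialCurve hm hwave' hinv'
    -- The velocities coincide on the half-plane, so the second wave's curve solves the first wave's
    -- root equation with the same starting point.
    have hγe : Set.EqOn γ' γ (Set.Ici 0) := hγu γ' ⟨hγ'.continuousOn, hγ'.start, fun σ hσ => by
      have hmem : (σ, γ' σ) ∈ hodographPlane := hσ
      rw [← e2 hmem]
      exact hγ'.equation σ hσ⟩
    obtain ⟨σ, hσ, rfl⟩ := hbij.surjOn hx
    have hσ0 : (0 : ℝ) ≤ σ := hσ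
    have hmem : (σ, γ σ) ∈ hodographPlane := hσ0
    have hd := hdata σ hσ0
    have hd' := hdata' σ hσ0
    rw [hγe hσ, e1 hmem, e2 hmem] at hd'
    exact ⟨hd'.1.trans hd.1.symm, hd'.2.trans hd.2.symm⟩
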